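/- **Conventions.** A metric measure space $(X,d,\mu)$ is a separable metric space with a Radon measure such that $0<\mu(B)<\infty$ for every ball $B$; $B_r(x)$ is the open ball and $u_A=\frac1{\mu(A)}\int_A u\,d\mu$. The measure $\mu$ is *locally doubling* if for every compact $K\subset X$ there are $C_K,r_K>0$ with $\mu(B_{2r}(x))\le C_K\,\mu(B_r(x))$ for all $x\in K$, $0<r\le r_K$. $X$ is a *length space* if $d(x,y)$ is the infimum of the lengths of curves joining $x$ and $y$; it is *proper* if closed balls are compact. An open set $\Omega\subset X$ is regarded as the metric measure space $(\Omega,d,\mu|_\Omega)$, and $L^p_{loc}(\Omega)$ consists of the functions that are in $L^p(K)$ for every compact $K\subset\Omega$. Put $\Delta_r u(x)=\dfrac{u_{B_r(x)}-u(x)}{r^2}$. * $M^{1,p}_{loc}(\Omega)$ is the set of Borel functions $u\in L^p_{loc}(\Omega)$ for which there are a null set $N$ and, for every compact $K\subset\Omega$, a non-negative $g_K\in L^p_{loc}(\Omega)$ and $r_K>0$ such that $|u(x)-u(y)|\le d(x,y)\,[g_K(x)+g_K(y)]$ for all $x,y\in K\setminus N$ with $d(x,y)<r_K$. * $\mathrm{AMV}^p_{loc}(\Omega)$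 is the set of $u\in L^p_{loc}(\Omega)$ with $\limsup_{r\to0}\|\Delta_r u\|_{L^p(K)}<\infty$ for every compact $K\subset\Omega$. * A function $v\in L^1_{loc}(Y)$ on a metric measure space $Y$ is *mv-harmonic* if $\Delta_r v=0$ on $K$ for every compact $K\subset Y$ and every $0<r<\sup\{\rho>0:\ \{y:\operatorname{dist}(y,K)\le\rho\}\text{ is compact}\}$. (If $Y$ is proper: $v(y)=v_{B_r(y)}$ for all $y\in Y$, $r>0$.) * Let $x\in\Omega$, let $s_m>0$ with $s_m\to0$, and let $X_m=(X,\,d/s_m,\,\mu_m,\,x)$ with $\mu_m=\mu/\mu(B_{s_m}(x))$. Let $u_m=(u-u(x))/s_m$ on $\Omega$, extended by $0$ to $X$. Let $X_\infty=(X_\infty,d_\infty,\mu_\infty,x_\infty)$ be a pointed proper metric measure space and $u_\infty\in L^1_{loc}(X_\infty)$. Then $u_\infty:X_\infty\to\mathbb R$ is an *approximate tangent map of $u$ at $x$ subordinate to $(s_m)$* if there are a proper metric space $Z$ and isometric embeddings $\iota_m:X_m\to Z$, $\iota:X_\infty\to Z$ such that (1) $\iota_m(x)=\iota(x_\infty)$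 for all $m$, and $F_m=\iota_m(X_m)$ Hausdorff-converges to $F=\iota(X_\infty)$, i.e. $\sup_{z\in F_m\cap B_R(q)}\operatorname{dist}(z,F)\to0$ and $\sup_{z\in F\cap B_R(q)}\operatorname{dist}(z,F_m)\to0$ for all $q\in Z$, $R>0$; (2) $\int\varphi\circ\iota_m\,d\mu_m\to\int\varphi\circ\iota\,d\mu_\infty$, and (3) $\int(\varphi\circ\iota_m)\,(u_m)_\pm\,d\mu_m\to\int(\varphi\circ\iota)\,(u_\infty)_\pm\,d\mu_\infty$ for both signs, where $a_+=\max\{a,0\}$ and $a_-=-\min\{a,0\}$, for every continuous $\varphi:Z\to\mathbb R$ with bounded support. **Theorem.** Let $\Omega$ be an open subset of a proper length space $X=(X,d,\mu)$ with a locally doubling measure $\mu$, and let $1<p<\infty$. Suppose $u\in M^{1,p}_{loc}(\Omega)\cap \mathrm{AMV}^p_{loc}(\Omega)$ and let $(r_k)$ be a sequence of positive numbers converging to zero. Then for $\mu$-almost every $x\in\Omega$, every approximate tangent map $u_\infty:X_\infty\to\mathbb R$ of $u$ at $x$ subordinate to a subsequence of $(r_k)$ is mv-harmonic; here $u_\infty$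 is regarded as an element of $L^1_{loc}(X_\infty)$, i.e. there is an mv-harmonic function $h$ on $X_\infty$ with $h=u_\infty$ $\mu_\infty$-almost everywhere. -/

import Mathlib

open MeasureTheory Filter Topology Metric Set
open scoped ENNReal NNReal

universe u v w

namespace AMVBlowup

noncomputable section

/-- The measure of a metric measure space: a Borel measure which is positive and finite on balls.
(On the proper, hence separable and locally compact, spaces considered here, such a measure is
automatically Radon.) -/
structure IsMetricMeasure {X : Type u} [MetricSpace X] [MeasurableSpace X]
    (μ : Measure X) : Prop where
  ball_pos : ∀ (x : X) (r : ℝ), 0 < r → 0 < μ (ball x r)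
  ball_lt_top : ∀ (x : X) (r : ℝ), μ (ball x r) < ∞

/-- A locally doubling measure. -/
def IsLocallyDoubling {X : Type u} [MetricSpace X] [MeasurableSpace X] (μ : Measure X) : Prop :=
  ∀ K : Set X, IsCompact K → ∃ (C : ℝ≥0) (rK : ℝ), 0 < rK ∧
    ∀ x ∈ K, ∀ r : ℝ, 0 < r → r ≤ rK → μ (ball x (2 * r)) ≤ C * μ (ball x r)

/-- A length space: the distance of two points is the infimum of the lengths (total variations)
of the continuous curves joining them. -/
def IsLengthSpace (X : Type u) [MetricSpace X] : Prop :=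
  ∀ x y : X, edist x y = ⨅ γ : Path x y, eVariationOn γ Set.univ

/-- The `r`-laplacian `Δ_r u (x) = (u_{B_r(x)} - u(x)) / r ^ 2`. -/
def rLaplacian {X : Type u} [MetricSpace X] [MeasurableSpace X] (μ : Measure X) (r : ℝ)
    (f : X → ℝ) (x : X) : ℝ :=
  ((⨍ y in ball x r, f y ∂μ) - f x) / r ^ 2

/-- Mean value harmonic functions: `f ∈ L¹_loc` and `Δ_r f = 0` on every compact set `K`, for
every positive `r < r_K`, where `r_K` is the supremum of the radii `ρ` for which the closed
`ρ`-neighbourhood of `K` is compact. -/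
def IsMeanValueHarmonic {X : Type u} [MetricSpace X] [MeasurableSpace X] (μ : Measure X)
    (f : X → ℝ) : Prop :=
  LocallyIntegrable f μ ∧
    ∀ K : Set X, IsCompact K → ∀ r ρ : ℝ, 0 < r → r < ρ → IsCompact (cthickening ρ K) →
      ∀ x ∈ K, rLaplacian μ r f x = 0

/-- `f ∈ L^p_loc(Ω)`: `f` is in `L^p` on every compact subset of `Ω`. -/
def MemLpLocOn {X : Type u} [MetricSpace X] [MeasurableSpace X] (μ : Measure X) (Ω : Set X)
    (p : ℝ≥0∞) (f : X → ℝ) : Prop :=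
  ∀ K : Set X, K ⊆ Ω → IsCompact K → MemLp f p (μ.restrict K)

/-- The local Hajłasz–Sobolev space `M^{1,p}_loc(Ω)`. Only the values of `f` on `Ω` matter. -/
def MemHajlaszLocOn {X : Type u} [MetricSpace X] [MeasurableSpace X] (μ : Measure X) (Ω : Set X)
    (p : ℝ≥0∞) (f : X → ℝ) : Prop :=
  Measurable (fun x : Ω => f x) ∧ MemLpLocOn μ Ω p f ∧
    ∃ N : Set X, μ N = 0 ∧ ∀ K : Set X, K ⊆ Ω → IsCompact K →
      ∃ (g : X → ℝ) (rK : ℝ), 0 < rK ∧ (∀ x, 0 ≤ g x) ∧ MemLpLocOn μ Ω p g ∧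
        ∀ x ∈ K \ N, ∀ y ∈ K \ N, dist x y < rK → |f x - f y| ≤ dist x y * (g x + g y)

/-- The class `AMV^p_loc(Ω)` of the metric measure space `(Ω, d, μ|_Ω)`, whose balls are the sets
`B_r(x) ∩ Ω`. Only the values of `f` on `Ω` matter. -/
def MemAMVLocOn {X : Type u} [MetricSpace X] [MeasurableSpace X] (μ : Measure X) (Ω : Set X)
    (p : ℝ≥0∞) (f : X → ℝ) : Prop :=
  MemLpLocOn μ Ω p f ∧
    ∀ K : Set X, K ⊆ Ω → IsCompact K →
      limsup (fun r : ℝ => eLpNorm (rLaplacian (μ.restrict Ω) r f) p (μ.restrict K)) (𝓝[>] 0) < ∞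

/-- Hausdorff convergence of the sets `F m` to `F` (on bounded parts of the space). -/
def HausdorffConverges {Z : Type w} [MetricSpace Z] (F : ℕ → Set Z) (F' : Set Z) : Prop :=
  ∀ (q : Z) (R : ℝ), 0 < R →
    Tendsto (fun m => ⨆ z ∈ F m ∩ ball q R, infEDist z F') atTop (𝓝 0) ∧
    Tendsto (fun m => ⨆ z ∈ F' ∩ ball q R, infEDist z (F m)) atTop (𝓝 0)

/-- Weak convergence in `Z` of the push-forwards under `ι m` of the signed measures `f m · μ m` to
the push-forward under `j` of `f' · ν`: convergence of the integrals of all continuous functions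
on `Z` with bounded support. -/
def PushforwardsConvergeWeakly {X : Type u} [MeasurableSpace X] {Y : Type v} [MeasurableSpace Y]
    {Z : Type w} [MetricSpace Z] (ι : ℕ → X → Z) (j : Y → Z) (μ : ℕ → Measure X) (ν : Measure Y)
    (f : ℕ → X → ℝ) (f' : Y → ℝ) : Prop :=
  ∀ φ : Z → ℝ, Continuous φ → Bornology.IsBounded (Function.support φ) →
    Tendsto (fun m => ∫ a, φ (ι m a) * f m a ∂(μ m)) atTop (𝓝 (∫ b, φ (j b) * f' b ∂ν))

/-- The maps `ι m : (X, d m) → Z` and `j : Y → Z` are isometric embeddings realizing the pointed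
measured Gromov–Hausdorff convergence of `(X, d m, μ m, x)` to `(Y, dist, ν, y₀)`. (All spaces of
the sequence have the same underlying set and the same base point.) -/
structure RealizesPMGH {X : Type u} [MeasurableSpace X] {Y : Type v} [MetricSpace Y]
    [MeasurableSpace Y] {Z : Type w} [MetricSpace Z] (d : ℕ → X → X → ℝ) (μ : ℕ → Measure X)
    (x : X) (ν : Measure Y) (y₀ : Y) (ι : ℕ → X → Z) (j : Y → Z) : Prop where
  isometry_seq : ∀ m a b, dist (ι m a) (ι m b) = d m a b
  isometry_lim : Isometry j
  base_point : ∀ m, ι m x = j y₀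
  hausdorff : HausdorffConverges (fun m => range (ι m)) (range j)
  weak : PushforwardsConvergeWeakly ι j μ ν (fun _ _ => 1) (fun _ => 1)

/-- The rescaled measure `μ / μ(B_r(x))`. -/
def rescaledMeasure {X : Type u} [MetricSpace X] [MeasurableSpace X] (μ : Measure X) (x : X)
    (r : ℝ) : Measure X :=
  (μ (ball x r))⁻¹ • μ

/-- The rescaled function `(f - f(x)) / r` of `f : Ω → ℝ`, extended by `0` outside `Ω`. -/
def rescaledFun {X : Type u} (Ω : Set X) (f : X → ℝ) (x : X) (r : ℝ) : X → ℝ :=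
  Ω.indicator fun a => (f a - f x) / r

/-- `f' : Y → ℝ`, on the pointed metric measure space `(Y, ν, y₀)`, is an approximate tangent at
`x` of `f : Ω → ℝ`, subordinate to the scales `s m → 0`: it is locally integrable and the rescaled
functions `(f - f(x)) / s m` on the rescaled spaces `(X, d / s m, μ / μ(B_{s m}(x)), x)` converge
weakly to `f'`, i.e. in some pointed proper metric space `Z` realizing the pointed measured
Gromov–Hausdorff convergence of the spaces, the positive and the negative parts converge weakly
as measures. -/
def IsApproximateTangent {X : Type u} [MetricSpace X] [MeasurableSpace X] (μ : Measure X)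
    (Ω : Set X) (f : X → ℝ) (x : X) (s : ℕ → ℝ) {Y : Type v} [MetricSpace Y] [MeasurableSpace Y]
    (ν : Measure Y) (y₀ : Y) (f' : Y → ℝ) : Prop :=
  LocallyIntegrable f' ν ∧
    ∃ (Z : Type w) (_ : MetricSpace Z) (_ : ProperSpace Z) (ι : ℕ → X → Z) (j : Y → Z),
      RealizesPMGH (fun m a b => dist a b / s m) (fun m => rescaledMeasure μ x (s m)) x ν y₀ ι j ∧
      PushforwardsConvergeWeakly ι j (fun m => rescaledMeasure μ x (s m)) ν
        (fun m a => max (rescaledFun Ω f x (s m) a) 0) (fun b => max (f' b) 0) ∧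
      PushforwardsConvergeWeakly ι j (fun m => rescaledMeasure μ x (s m)) ν
        (fun m a => -min (rescaledFun Ω f x (s m) a) 0) (fun b => -min (f' b) 0)

end

end AMVBlowup

/-!
Blow up `f` at `x` at the scales `s m`, and let `U m` be the rescaled functions. The mean value
defect `u_{B_R(y)} - u(y)` of `U m` on the rescaled space is, up to a factor, the mean value defect
of `f` for the radius `R * s m`, divided by `s m`. The `AMV` condition says that the latter is
of order `s m` in `L¹` on compact sets, so the averages of the defects of `U m` over balls about `x`
are summable along geometric sequences of radii, for almost every `x` (Tonelli's theorem:
`ae_tendsto_average_defect`). This does not cover arbitrary scales, and the exceptional null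
set must not depend on the sequence. But geometric sequences with countably many ratios
`q` close to `1` provide, for each small radius `ρ`, a radius `σ` in `[q * ρ, ρ]` at which the
defect is small (`ae_exists_scale`). Passing from `σ` to `ρ` costs at most the
`L¹` norm of `U m` times the measure of thin annuli (`lintegral_kernel_defect_le`). The measure of
thin annuli is small by the annular decay of locally doubling measures on length spaces
(`exists_measure_annulus_le`), and the `L¹` norms of `U m` are bounded on balls because the
positive and negative parts of `U m` converge weakly. For the same reason one may
replace the indicator functions of balls by the Lipschitz kernel `cutoff R δ`, at a cost which is
uniform in `m` and vanishes with `δ` (`exists_rescaled_defect_le`).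

With a Lipschitz kernel `η` the tested mean value defect is a difference of double integrals
`∫ φ(a) ∫ η(d(a, b)) u(b) - ∫ φ(a) ∫ η(d(a, b)) u(a)`, and both pass to the limit: the inner
integrals are equi-Lipschitz functions on `Z`, so they converge locally uniformly
(`tendsto_double_integral`). Letting `δ → 0` on the limit space gives the mean value property of
the limit for each radius at almost every point (`integral_mul_setIntegral_ball_eq`). Annular decay
also passes to the limit, where spheres are therefore null sets (`measure_sphere_eq_zero`). Hence
averages over balls are continuous on the limit space, and the averages over balls of radius one are
a mean value harmonic representative (`exists_isMeanValueHarmonic`).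
-/

/-! ### Annular decay in length spaces -/

namespace AMVBlowup

/-- The point at distance `l` from `a` on an almost shortest curve from `a` to `y`. -/
theorem IsLengthSpace.exists_dist_eq {X : Type u} [MetricSpace X] (h : IsLengthSpace X) (a y : X)
    {l ε : ℝ} (hl : 0 ≤ l) (hly : l ≤ dist a y) (hε : 0 < ε) :
    ∃ z, dist a z = l ∧ dist z y < dist a y - l + ε := by
  have h1 : ⨅ γ : Path a y, eVariationOn γ Set.univ < edist a y + ENNReal.ofReal ε := by
    rw [← h a y]
    exact ENNReal.lt_add_right (edist_ne_top _ _) (by simpa using hε)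
  obtain ⟨γ, hγ⟩ := iInf_lt_iff.1 h1
  have hcont : Continuous fun s => dist a (γ s) := continuous_const.dist γ.continuous
  have hmem : l ∈ Icc (dist a (γ 0)) (dist a (γ 1)) := by simp [hl, hly]
  obtain ⟨s, hs⟩ := intermediate_value_univ 0 1 hcont hmem
  refine ⟨γ s, hs, ?_⟩
  have h2 := eVariationOn.add_le_union (fun t => γ t) (s := Iic s) (t := Ici s)
    (fun x hx y hy => le_trans hx hy)
  have h3 : edist a (γ s) ≤ eVariationOn γ (Iic s) := by
    simpa using eVariationOn.edist_le γ (s := Iic s) (x := 0) (y := s)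
      (mem_Iic.2 s.2.1) (mem_Iic.2 le_rfl)
  have h4 : edist (γ s) y ≤ eVariationOn γ (Ici s) := by
    simpa using eVariationOn.edist_le γ (s := Ici s) (x := s) (y := 1)
      (mem_Ici.2 le_rfl) (mem_Ici.2 s.2.2)
  rw [Iic_union_Ici] at h2
  have h5 : edist a (γ s) + edist (γ s) y < edist a y + ENNReal.ofReal ε :=
    lt_of_le_of_lt (le_trans (add_le_add h3 h4) h2) hγ
  rw [edist_dist, edist_dist, edist_dist, ← ENNReal.ofReal_add dist_nonneg dist_nonneg,
    ← ENNReal.ofReal_add dist_nonneg hε.le, ENNReal.ofReal_lt_ofReal_iff (by positivity)] at h5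
  have hs' : dist a (γ s) = l := hs
  linarith

/-- One step of the annular decay: the outer annulus of width `t` of a ball of radius `ρ` is
controlled by the adjacent annulus of width `2 * t`. Each point of the outer annulus has, along an
almost shortest curve to the centre, a point at distance less than `3 * t` in the middle of the
adjacent annulus; the balls of radius `t / 2` about a well chosen family of these points are
disjoint. -/
theorem measure_annulus_le {X : Type u} [MetricSpace X] [ProperSpace X] [MeasurableSpace X]
    [BorelSpace X] {μ : Measure X} (hlength : IsLengthSpace X) {K : Set X} {C : ℝ≥0} {rK : ℝ}
    (hK : ∀ x ∈ K, ∀ r : ℝ, 0 < r → r ≤ rK → μ (ball x (2 * r)) ≤ C * μ (ball x r))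
    {a : X} {ρ t : ℝ} (haK : ball a ρ ⊆ K) (ht : 0 < t) (htρ : 3 * t ≤ ρ) (htr : 4 * t ≤ rK) :
    μ {b | ρ - t ≤ dist a b ∧ dist a b < ρ} ≤
      C ^ 4 * μ {b | ρ - 3 * t ≤ dist a b ∧ dist a b < ρ - t} := by
  set A := {b | ρ - t ≤ dist a b ∧ dist a b < ρ} with hA
  have hex : ∀ y : X, ∃ z, y ∈ A → dist a z = ρ - 2 * t ∧ dist z y < 3 * t := by
    intro y
    by_cases hy : y ∈ A
    · obtain ⟨z, hz1, hz2⟩ := hlength.exists_dist_eq a y (l := ρ - 2 * t) (by linarith)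
        (by linarith [hy.1]) ht
      exact ⟨z, fun _ => ⟨hz1, by linarith [hy.2]⟩⟩
    · exact ⟨y, fun h => absurd h hy⟩
  choose z hz using hex
  obtain ⟨S, hSA, hSdisj, hScov⟩ :=
    Vitali.exists_disjoint_subfamily_covering_enlargement_closedBall A z (fun _ => t / 2) (t / 2)
      (fun _ _ => le_rfl) 5 (by norm_num)
  have hScount : S.Countable := hSdisj.countable_of_nonempty_interior fun i _ =>
    ⟨z i, ball_subset_interior_closedBall (mem_ball_self (by linarith))⟩
  -- `y` is at distance less than `3 * t + 5 * (t / 2) < 8 * t` from some selected centre `z b`, and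
  -- four doublings of the disjoint balls of radius `t / 2` reach the radius `8 * t`
  have hcover : A ⊆ ⋃ b ∈ S, ball (z b) (2 * (2 * (2 * (2 * (t / 2))))) := by
    intro y hy
    obtain ⟨b, hbS, hb⟩ := hScov y hy
    have h1 : dist (z y) (z b) ≤ 5 * (t / 2) := hb (mem_closedBall_self (by linarith))
    have h2 := (hz y hy).2
    have h3 := dist_triangle y (z y) (z b)
    rw [dist_comm y (z y)] at h3
    exact mem_iUnion₂.2 ⟨b, hbS, by rw [mem_ball]; linarith⟩
  have hdoub : ∀ b ∈ S, μ (ball (z b) (2 * (2 * (2 * (2 * (t / 2)))))) ≤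
      C ^ 4 * μ (ball (z b) (t / 2)) := by
    intro b hb
    have hzK : z b ∈ K := haK (by rw [mem_ball, dist_comm, (hz b (hSA hb)).1]; linarith)
    have h1 := hK _ hzK (2 * (2 * (2 * (t / 2)))) (by linarith) (by linarith)
    have h2 := hK _ hzK (2 * (2 * (t / 2))) (by linarith) (by linarith)
    have h3 := hK _ hzK (2 * (t / 2)) (by linarith) (by linarith)
    have h4 := hK _ hzK (t / 2) (by linarith) (by linarith)
    calc _ ≤ _ := h1
      _ ≤ C * (C * (C * (C * μ (ball (z b) (t / 2))))) := by gcongr; exact h2.trans (by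
          gcongr; exact h3.trans (by gcongr))
      _ = _ := by ring
  calc μ A ≤ μ (⋃ b ∈ S, ball (z b) (2 * (2 * (2 * (2 * (t / 2)))))) := measure_mono hcover
    _ ≤ ∑' b : S, μ (ball (z b) (2 * (2 * (2 * (2 * (t / 2)))))) := measure_biUnion_le _ hScount _
    _ ≤ ∑' b : S, C ^ 4 * μ (ball (z b) (t / 2)) := ENNReal.tsum_le_tsum fun b => hdoub b b.2
    _ = C ^ 4 * μ (⋃ b ∈ S, ball (z b) (t / 2)) := by
      rw [ENNReal.tsum_mul_left, measure_biUnion hScount _ fun _ _ => measurableSet_ball]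
      exact hSdisj.mono fun i => ball_subset_closedBall
    _ ≤ _ := by
      gcongr
      refine iUnion₂_subset fun b hb w hw => ?_
      have h1 := (hz b (hSA hb)).1
      have h2 := dist_triangle a (z b) w
      have h3 := dist_triangle a w (z b)
      rw [mem_ball] at hw
      rw [dist_comm (z b) w] at h2
      exact ⟨by linarith, by linarith⟩

/-- Locally uniformly in the centre and at small radii, thin annuli carry a small proportion of the
measure: by `measure_annulus_le`, dividing the width of the outer annulus by `3` reduces its
measure at least by the fixed factor `θ < 1`. -/
theorem exists_measure_annulus_le {X : Type u} [MetricSpace X] [ProperSpace X]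
    [MeasurableSpace X] [BorelSpace X] {μ : Measure X}
    (hdoubling : IsLocallyDoubling μ) (hlength : IsLengthSpace X) (x : X) {τ : ℝ≥0∞}
    (hτ : τ ≠ 0) :
    ∃ δ r₀ : ℝ, 0 < δ ∧ δ < 1 ∧ 0 < r₀ ∧ ∀ a ∈ ball x r₀, ∀ r : ℝ, 0 < r → r < r₀ →
      μ {b | (1 - δ) * r ≤ dist a b ∧ dist a b < (1 + δ) * r} ≤ τ * μ (ball a (2 * r)) := by
  obtain ⟨C, rK, hrK, hK⟩ := hdoubling (closedBall x 1) (isCompact_closedBall x 1)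
  set D : ℝ≥0∞ := (C : ℝ≥0∞) ^ 4 with hD
  have hDtop : D ≠ ∞ := by finiteness
  set θ : ℝ≥0∞ := D / (1 + D) with hθ
  have hθ1 : θ < 1 := by
    rw [hθ, ENNReal.div_lt_iff (by simp) (by simp [hDtop]), one_mul, add_comm]
    exact ENNReal.lt_add_right hDtop one_ne_zero
  have hiter : ∀ (a : X) (ρ : ℝ), 0 < ρ → ball a ρ ⊆ closedBall x 1 → 4 * ρ ≤ rK → ∀ n : ℕ,
      μ {b | ρ - ρ / 3 ^ n ≤ dist a b ∧ dist a b < ρ} ≤ θ ^ n * μ (ball a ρ) := by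
    intro a ρ hρ hsub hρr n
    induction n with
    | zero =>
      simp only [pow_zero, div_one, sub_self, one_mul]
      exact measure_mono fun b hb => by simpa [dist_comm] using hb.2
    | succ n ih =>
      set t := ρ / 3 ^ (n + 1) with ht
      have ht0 : 0 < t := by positivity
      have h3t : ρ / 3 ^ n = 3 * t := by rw [ht, pow_succ]; field_simp
      have hle : 3 * t ≤ ρ := by
        rw [← h3t]; exact div_le_self hρ.le (one_le_pow₀ (by norm_num))
      rw [h3t] at ih
      have hstep := measure_annulus_le hlength hK hsub ht0 hle (by linarith)
      set A := {b | ρ - t ≤ dist a b ∧ dist a b < ρ}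
      set A' := {b | ρ - 3 * t ≤ dist a b ∧ dist a b < ρ - t}
      have hAm : MeasurableSet A :=
        (measurableSet_Ico (a := ρ - t) (b := ρ)).preimage
          (continuous_const.dist continuous_id : Continuous fun b => dist a b).measurable
      have hunion : μ A + μ A' ≤ μ {b | ρ - 3 * t ≤ dist a b ∧ dist a b < ρ} := by
        rw [add_comm, ← measure_union _ hAm]
        · refine measure_mono ?_
          rintro b (hb | hb)
          · exact ⟨hb.1, by linarith [hb.2]⟩
          · exact ⟨by linarith [hb.1], hb.2⟩
        · exact disjoint_left.2 fun b hb hb' => absurd hb.2 (not_lt.2 hb'.1)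
      have h1 : (1 + D) * μ A ≤ D * (θ ^ n * μ (ball a ρ)) := by
        calc (1 + D) * μ A = μ A + D * μ A := by ring
          _ ≤ D * μ A' + D * μ A := by gcongr
          _ = D * (μ A + μ A') := by ring
          _ ≤ _ := by gcongr; exact hunion.trans ih
      calc μ A ≤ (1 + D)⁻¹ * (D * (θ ^ n * μ (ball a ρ))) := by
            rw [mul_comm (1 + D)⁻¹, ← div_eq_mul_inv,
              ENNReal.le_div_iff_mul_le (Or.inl (by simp)) (Or.inl (by simp [hDtop])), mul_comm]
            exact h1
        _ = θ ^ (n + 1) * μ (ball a ρ) := by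
            rw [pow_succ, hθ, div_eq_mul_inv]; ring
  obtain ⟨n, hn⟩ : ∃ n : ℕ, θ ^ n < τ :=
    ((ENNReal.tendsto_pow_atTop_nhds_zero_of_lt_one hθ1).eventually
      (gt_mem_nhds (pos_iff_ne_zero.2 hτ))).exists
  have h3n : (1 : ℝ) ≤ 3 ^ n := one_le_pow₀ (by norm_num)
  have h3n' : (0 : ℝ) < (3 ^ n)⁻¹ := by positivity
  have h3n'' : ((3 : ℝ) ^ n)⁻¹ ≤ 1 := inv_le_one_of_one_le₀ h3n
  -- the outer annulus of width `ρ / 3 ^ n` for `ρ = (1 + δ) * r` contains the annulus between the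
  -- radii `(1 - δ) * r` and `(1 + δ) * r` as soon as `2 * δ ≤ 3⁻ⁿ`
  refine ⟨(3 ^ n)⁻¹ / 2, min (1 / 4) (rK / 8), by linarith, by linarith, by positivity,
    fun a ha r hr hr₀ => ?_⟩
  set δ : ℝ := (3 ^ n)⁻¹ / 2 with hδ
  have hr1 := hr₀.trans_le (min_le_left _ _)
  have hr2 := hr₀.trans_le (min_le_right _ _)
  have ha1 := (mem_ball.1 ha).trans_le (min_le_left _ _)
  have hδr : (1 + δ) * r ≤ 2 * r := by gcongr; linarith
  have hρ : 0 < (1 + δ) * r := by positivity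
  have h := hiter a ((1 + δ) * r) hρ (fun b hb => by
    have := dist_triangle b a x
    rw [mem_ball] at hb
    rw [mem_closedBall]; linarith) (by linarith) n
  refine (measure_mono ?_).trans (h.trans (mul_le_mul' hn.le (measure_mono (ball_subset_ball hδr))))
  rintro b ⟨hb1, hb2⟩
  refine ⟨?_, hb2⟩
  have : (1 + δ) * r / 3 ^ n = (1 + δ) * r * (2 * δ) := by rw [hδ]; field_simp
  rw [this]
  nlinarith [mul_pos hr (show 0 < δ by positivity), mul_pos (mul_pos hr (show 0 < δ by positivity)) (show 0 < δ by positivity)]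

/-! ### Decay of the mean value defect at almost every point -/

theorem IsMetricMeasure.isLocallyFiniteMeasure {X : Type u} [MetricSpace X] [MeasurableSpace X]
    {μ : Measure X} (hμ : IsMetricMeasure μ) : IsLocallyFiniteMeasure μ :=
  ⟨fun x => ⟨ball x 1, ball_mem_nhds x one_pos, hμ.ball_lt_top x 1⟩⟩

theorem IsMetricMeasure.isOpenPosMeasure {X : Type u} [MetricSpace X] [MeasurableSpace X]
    {μ : Measure X} (hμ : IsMetricMeasure μ) : μ.IsOpenPosMeasure := by
  refine ⟨fun U hU ⟨x, hx⟩ => ?_⟩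
  obtain ⟨ε, hε, hsub⟩ := Metric.isOpen_iff.1 hU x hx
  exact ((hμ.ball_pos x ε hε).trans_le (measure_mono hsub)).ne'

section Measurability

variable {X : Type u} [MetricSpace X] [SecondCountableTopology X] [MeasurableSpace X]
  [BorelSpace X] {μ : Measure X} [SFinite μ]

theorem measurableSet_dist_lt (t : ℝ) : MeasurableSet {p : X × X | dist p.1 p.2 < t} :=
  (isOpen_lt (continuous_fst.dist continuous_snd) continuous_const).measurableSet

theorem measurable_measure_ball (t : ℝ) : Measurable fun y => μ (ball y t) := by
  convert measurable_measure_prodMk_left (ν := μ) (measurableSet_dist_lt (X := X) t) using 3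
  ext b
  simp [dist_comm]

theorem measurable_setLIntegral_ball {G : X → ℝ≥0∞} (hG : Measurable G) (t : ℝ) :
    Measurable fun y => ∫⁻ b in ball y t, G b ∂μ := by
  have h : Measurable fun p : X × X => {p : X × X | dist p.1 p.2 < t}.indicator
      (fun p => G p.2) p := (hG.comp measurable_snd).indicator (measurableSet_dist_lt t)
  convert h.lintegral_prod_right' (ν := μ) using 2 with y
  rw [← lintegral_indicator measurableSet_ball]
  refine lintegral_congr fun b => ?_
  by_cases hb : dist y b < t
  · simp [indicator, hb, dist_comm b y]
  · simp [indicator, hb, dist_comm b y]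

theorem measurable_setIntegral_ball {F : X → ℝ} (hF : Measurable F) (t : ℝ) :
    Measurable fun y => ∫ b in ball y t, F b ∂μ := by
  have h : Measurable fun p : X × X => {p : X × X | dist p.1 p.2 < t}.indicator
      (fun p => F p.2) p := (hF.comp measurable_snd).indicator (measurableSet_dist_lt t)
  convert (h.stronglyMeasurable.integral_prod_right' (ν := μ)).measurable using 2 with y
  rw [← integral_indicator measurableSet_ball]
  refine integral_congr_ae (ae_of_all _ fun b => ?_)
  by_cases hb : dist y b < t
  · simp [indicator, hb, dist_comm b y]
  · simp [indicator, hb, dist_comm b y]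

theorem measurable_setAverage_ball {F : X → ℝ} (hF : Measurable F) (t : ℝ) :
    Measurable fun y => ⨍ b in ball y t, F b ∂μ := by
  simp_rw [setAverage_eq, smul_eq_mul]
  exact ((measurable_measure_ball t).ennreal_toReal.inv).mul (measurable_setIntegral_ball hF t)

end Measurability

/-- By Tonelli's theorem, averaging over balls is bounded on `L¹`, locally and at small scales. -/
theorem lintegral_ball_average_le {X : Type u} [MetricSpace X] [ProperSpace X]
    [MeasurableSpace X] [BorelSpace X] {μ : Measure X} (hμ : IsMetricMeasure μ) {x₀ : X}
    {ρ t rK : ℝ} {C : ℝ≥0} (hK : ∀ x ∈ closedBall x₀ (2 * ρ), ∀ r : ℝ, 0 < r → r ≤ rK →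
      μ (ball x (2 * r)) ≤ C * μ (ball x r)) (ht : 0 < t) (htρ : t < ρ) (htr : t ≤ rK)
    {G : X → ℝ≥0∞} (hG : Measurable G) :
    ∫⁻ x in ball x₀ ρ, (μ (ball x t))⁻¹ * ∫⁻ y in ball x t, G y ∂μ ∂μ ≤
      C * ∫⁻ y in closedBall x₀ (2 * ρ), G y ∂μ := by
  have := hμ.isLocallyFiniteMeasure
  have hle : ∀ x ∈ ball x₀ ρ, (μ (ball x t))⁻¹ * ∫⁻ y in ball x t, G y ∂μ ≤
      ∫⁻ y, {p : X × X | dist p.1 p.2 < t}.indicator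
        (fun p => C * ((μ (ball p.2 t))⁻¹ * G p.2)) (x, y) ∂(μ.restrict (closedBall x₀ (2 * ρ))) := by
    intro x hx
    rw [mem_ball] at hx
    have hsub : ball x t ⊆ closedBall x₀ (2 * ρ) := fun y hy => by
      rw [mem_ball] at hy
      rw [mem_closedBall]
      linarith [dist_triangle y x x₀]
    rw [← lintegral_const_mul _ hG]
    have : ∀ y, {p : X × X | dist p.1 p.2 < t}.indicator
        (fun p => C * ((μ (ball p.2 t))⁻¹ * G p.2)) (x, y) =
        (ball x t).indicator (fun y => C * ((μ (ball y t))⁻¹ * G y)) y := fun y => by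
      by_cases hb : dist x y < t
      · simp [indicator, hb, dist_comm y x]
      · simp [indicator, hb, dist_comm y x]
    simp_rw [this]
    rw [lintegral_indicator measurableSet_ball, Measure.restrict_restrict measurableSet_ball,
      inter_eq_self_of_subset_left hsub]
    refine setLIntegral_mono' measurableSet_ball fun y hy => ?_
    rw [← mul_assoc]
    gcongr
    rw [ENNReal.inv_le_iff_inv_le, ENNReal.mul_inv (Or.inr (by simp [(hμ.ball_pos y t ht).ne']))
      (Or.inr (by simp [(hμ.ball_lt_top y t).ne])), inv_inv]
    rw [mem_ball] at hy
    have h1 : μ (ball y t) ≤ C * μ (ball x t) :=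
      (measure_mono fun z hz => by
        rw [mem_ball] at hz ⊢
        linarith [dist_triangle z y x]).trans
        (hK x (by rw [mem_closedBall]; linarith [dist_nonneg (x := x) (y := x₀)]) t ht htr)
    by_cases hC : (C : ℝ≥0∞) = 0
    · rw [hC, zero_mul] at h1
      exact absurd h1 (not_le.2 (hμ.ball_pos y t ht))
    · rw [mul_comm, ← div_eq_mul_inv]
      exact ENNReal.div_le_of_le_mul' h1
  calc _ ≤ ∫⁻ x in ball x₀ ρ, ∫⁻ y, {p : X × X | dist p.1 p.2 < t}.indicator
        (fun p => C * ((μ (ball p.2 t))⁻¹ * G p.2)) (x, y)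
          ∂(μ.restrict (closedBall x₀ (2 * ρ))) ∂μ := setLIntegral_mono' measurableSet_ball hle
    _ = ∫⁻ y in closedBall x₀ (2 * ρ), ∫⁻ x in ball x₀ ρ, {p : X × X | dist p.1 p.2 < t}.indicator
        (fun p => C * ((μ (ball p.2 t))⁻¹ * G p.2)) (x, y) ∂μ ∂μ := by
      refine lintegral_lintegral_swap (Measurable.aemeasurable ?_)
      exact Measurable.indicator ((((measurable_measure_ball t).comp measurable_snd).inv.mul
        (hG.comp measurable_snd)).const_mul _) (measurableSet_dist_lt t)
    _ ≤ ∫⁻ y in closedBall x₀ (2 * ρ), C * G y ∂μ := by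
      refine lintegral_mono fun y => ?_
      calc _ ≤ ∫⁻ x, (ball y t).indicator (fun _ => C * ((μ (ball y t))⁻¹ * G y)) x ∂μ :=
            (setLIntegral_le_lintegral _ _).trans (lintegral_mono fun x => by
              by_cases hb : dist x y < t
              · simp [indicator, hb]
              · simp [indicator, hb])
        _ = C * G y * ((μ (ball y t))⁻¹ * μ (ball y t)) := by
            rw [lintegral_indicator measurableSet_ball, setLIntegral_const]; ring
        _ = C * G y := by
            rw [ENNReal.inv_mul_cancel (hμ.ball_pos y t ht).ne' (hμ.ball_lt_top y t).ne, mul_one]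
    _ = _ := lintegral_const_mul _ hG

/-- The `L¹` form of the `AMV` condition, with the balls of the ambient space. -/
theorem MemAMVLocOn.exists_lintegral_le {X : Type u} [MetricSpace X] [ProperSpace X]
    [MeasurableSpace X] [BorelSpace X] {μ : Measure X} (hμ : IsMetricMeasure μ) {Ω : Set X}
    (hΩ : IsOpen Ω) {p : ℝ≥0∞} (hp : 1 ≤ p) {f : X → ℝ} (hf : MemAMVLocOn μ Ω p f)
    (hmeas : Measurable (Ω.indicator f)) {K : Set X} (hK : IsCompact K) (hKΩ : K ⊆ Ω) :
    ∃ M : ℝ≥0∞, M ≠ ∞ ∧ ∀ᶠ r in 𝓝[>] (0 : ℝ),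
      ∫⁻ y in K, ‖(⨍ b in ball y r, Ω.indicator f b ∂μ) - Ω.indicator f y‖ₑ ∂μ ≤
        M * ENNReal.ofReal (r ^ 2) := by
  have := hμ.isLocallyFiniteMeasure
  obtain ⟨M, hM1, hM⟩ := exists_between (hf.2 K hKΩ hK)
  have hev := eventually_lt_of_limsup_lt hM1
  obtain ⟨ε, hε, hεΩ⟩ := hK.exists_cthickening_subset_open hΩ hKΩ
  set e : ℝ := 1 / (1 : ℝ≥0∞).toReal - 1 / p.toReal
  have he : 0 ≤ e := by
    simp only [e, ENNReal.toReal_one, div_one, sub_nonneg]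
    by_cases hp' : p = ∞
    · simp [hp']
    · have := (ENNReal.toReal_le_toReal ENNReal.one_ne_top hp').2 hp
      rw [ENNReal.toReal_one] at this
      exact div_le_one_of_le₀ this (by positivity)
  refine ⟨M * μ K ^ e, ENNReal.mul_ne_top hM.ne
    (ENNReal.rpow_ne_top_of_nonneg he hK.measure_lt_top.ne), ?_⟩
  filter_upwards [hev, Ioo_mem_nhdsGT hε] with r hr ⟨hr0, hrε⟩
  have hball : ∀ y ∈ K, ball y r ⊆ Ω := fun y hy b hb =>
    hεΩ (mem_cthickening_of_dist_le b y ε K hy ((mem_ball.1 hb).le.trans hrε.le))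
  have hlap : ∀ y ∈ K, (⨍ b in ball y r, Ω.indicator f b ∂μ) - Ω.indicator f y =
      r ^ 2 * rLaplacian (μ.restrict Ω) r f y := by
    intro y hy
    rw [rLaplacian, Measure.restrict_restrict measurableSet_ball,
      inter_eq_self_of_subset_left (hball y hy), indicator_of_mem (hKΩ hy),
      setAverage_congr_fun (g := f) measurableSet_ball
        (ae_of_all _ fun b hb => indicator_of_mem (hball y hy hb) f)]
    field_simp
  have hsm : AEStronglyMeasurable (rLaplacian (μ.restrict Ω) r f) (μ.restrict K) := by
    have h1 : Measurable fun y =>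
        ((⨍ b in ball y r, Ω.indicator f b ∂μ) - Ω.indicator f y) / r ^ 2 :=
      ((measurable_setAverage_ball hmeas r).sub hmeas).div_const _
    refine h1.aestronglyMeasurable.congr ?_
    filter_upwards [ae_restrict_mem hK.measurableSet] with y hy
    rw [hlap y hy]
    field_simp
  have h1 := eLpNorm_le_eLpNorm_mul_rpow_measure_univ hp hsm
  rw [Measure.restrict_apply_univ, eLpNorm_one_eq_lintegral_enorm] at h1
  calc _ = ∫⁻ y in K, ENNReal.ofReal (r ^ 2) * ‖rLaplacian (μ.restrict Ω) r f y‖ₑ ∂μ := by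
        refine setLIntegral_congr_fun hK.measurableSet fun y hy => ?_
        rw [hlap y hy, enorm_mul, Real.enorm_eq_ofReal (by positivity)]
    _ = ENNReal.ofReal (r ^ 2) * ∫⁻ y in K, ‖rLaplacian (μ.restrict Ω) r f y‖ₑ ∂μ :=
        lintegral_const_mul' _ _ ENNReal.ofReal_ne_top
    _ ≤ ENNReal.ofReal (r ^ 2) * (M * μ K ^ e) := by
        gcongr
        exact h1.trans (by gcongr)
    _ = _ := mul_comm _ _

/-- Along the geometric sequence of scales `q ^ j`, the `L¹` norms of the averages of the mean value
defects are summable after division by the scale, whence they tend to zero almost everywhere. -/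
theorem ae_tendsto_average_defect {X : Type u} [MetricSpace X] [ProperSpace X]
    [MeasurableSpace X] [BorelSpace X] {μ : Measure X} (hμ : IsMetricMeasure μ)
    (hdoubling : IsLocallyDoubling μ) {Ω : Set X} (hΩ : IsOpen Ω) {F : X → ℝ} (hF : Measurable F)
    (hdefect : ∀ K : Set X, IsCompact K → K ⊆ Ω → ∃ M : ℝ≥0∞, M ≠ ∞ ∧ ∀ᶠ r in 𝓝[>] (0 : ℝ),
      ∫⁻ y in K, ‖(⨍ b in ball y r, F b ∂μ) - F y‖ₑ ∂μ ≤ M * ENNReal.ofReal (r ^ 2))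
    {q T : ℝ} (hq0 : 0 < q) (hq1 : q < 1) (hT : 0 < T) :
    ∀ᵐ x ∂μ, x ∈ Ω → Tendsto (fun j : ℕ => (ENNReal.ofReal (q ^ j))⁻¹ *
      ((μ (ball x (T * q ^ j)))⁻¹ * ∫⁻ y in ball x (T * q ^ j),
        ‖(⨍ b in ball y (q ^ j), F b ∂μ) - F y‖ₑ ∂μ)) atTop (𝓝 0) := by
  have := hμ.isLocallyFiniteMeasure
  set G : ℕ → X → ℝ≥0∞ := fun j y => ‖(⨍ b in ball y (q ^ j), F b ∂μ) - F y‖ₑ with hG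
  have hGm : ∀ j, Measurable (G j) := fun j =>
    ((measurable_setAverage_ball hF _).sub hF).enorm
  set Φ : ℕ → X → ℝ≥0∞ := fun j x => (ENNReal.ofReal (q ^ j))⁻¹ *
      ((μ (ball x (T * q ^ j)))⁻¹ * ∫⁻ y in ball x (T * q ^ j), G j y ∂μ) with hΦ
  have hΦm : ∀ j, Measurable (Φ j) := fun j =>
    (((measurable_measure_ball _).inv.mul (measurable_setLIntegral_ball (hGm j) _))).const_mul _
  have hqj : Tendsto (fun j : ℕ => q ^ j) atTop (𝓝[>] 0) :=
    tendsto_nhdsWithin_iff.2 ⟨tendsto_pow_atTop_nhds_zero_of_lt_one hq0.le hq1,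
      Eventually.of_forall fun j => pow_pos hq0 j⟩
  rw [ae_iff]
  refine measure_null_of_locally_null _ fun x₀ hx₀ => ?_
  have hx₀Ω : x₀ ∈ Ω := by by_contra h; exact hx₀ fun h' => absurd h' h
  obtain ⟨ρ', hρ', hsub'⟩ := Metric.isOpen_iff.1 hΩ x₀ hx₀Ω
  set ρ := ρ' / 4 with hρdef
  have hρ : 0 < ρ := by positivity
  have hsub : closedBall x₀ (2 * ρ) ⊆ Ω :=
    (closedBall_subset_ball (by rw [hρdef]; linarith)).trans hsub'
  refine ⟨_, inter_mem_nhdsWithin _ (ball_mem_nhds x₀ hρ), ?_⟩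
  obtain ⟨C, rK, hrK, hK⟩ := hdoubling _ (isCompact_closedBall x₀ (2 * ρ))
  obtain ⟨M, hM, hMev⟩ := hdefect _ (isCompact_closedBall x₀ (2 * ρ)) hsub
  have hsmall : ∀ᶠ j : ℕ in atTop, T * q ^ j < min ρ rK := by
    have : Tendsto (fun j : ℕ => T * q ^ j) atTop (𝓝 (T * 0)) :=
      (tendsto_pow_atTop_nhds_zero_of_lt_one hq0.le hq1).const_mul T
    rw [mul_zero] at this
    exact this.eventually (gt_mem_nhds (by positivity))
  obtain ⟨J, hJ⟩ := eventually_atTop.1 (hsmall.and (hqj.eventually hMev))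
  have hint : ∀ j, ∫⁻ x in ball x₀ ρ, Φ (j + J) x ∂μ ≤ C * M * ENNReal.ofReal (q ^ (j + J)) := by
    intro j
    obtain ⟨h1, h2⟩ := hJ (j + J) (by omega)
    have hpos : 0 < q ^ (j + J) := pow_pos hq0 _
    calc _ = (ENNReal.ofReal (q ^ (j + J)))⁻¹ * ∫⁻ x in ball x₀ ρ,
          (μ (ball x (T * q ^ (j + J))))⁻¹ *
            ∫⁻ y in ball x (T * q ^ (j + J)), G (j + J) y ∂μ ∂μ :=
          lintegral_const_mul' _ _ (by simpa using hpos)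
      _ ≤ (ENNReal.ofReal (q ^ (j + J)))⁻¹ * (C * (M * ENNReal.ofReal ((q ^ (j + J)) ^ 2))) := by
          gcongr
          exact (lintegral_ball_average_le hμ hK (by positivity) (h1.trans_le (min_le_left _ _))
            (h1.le.trans (min_le_right _ _)) (hGm _)).trans (by gcongr)
      _ = C * M * (((ENNReal.ofReal (q ^ (j + J)))⁻¹ * ENNReal.ofReal (q ^ (j + J))) *
            ENNReal.ofReal (q ^ (j + J))) := by
          rw [pow_two, ENNReal.ofReal_mul hpos.le]; ring
      _ = _ := by
          rw [ENNReal.inv_mul_cancel (by simpa using hpos) ENNReal.ofReal_ne_top, one_mul]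
  have hsum : ∫⁻ x in ball x₀ ρ, ∑' j, Φ (j + J) x ∂μ ≠ ∞ := by
    rw [lintegral_tsum fun j => (hΦm _).aemeasurable]
    refine ne_top_of_le_ne_top ?_ (ENNReal.tsum_le_tsum hint)
    rw [ENNReal.tsum_mul_left]
    refine ENNReal.mul_ne_top (by finiteness) ?_
    have hs : Summable fun j : ℕ => q ^ (j + J) :=
      (summable_nat_add_iff J).2 (summable_geometric_of_lt_one hq0.le hq1)
    rw [← ENNReal.ofReal_tsum_of_nonneg (fun j => (pow_pos hq0 _).le) hs]
    exact ENNReal.ofReal_ne_top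
  have hae := ae_lt_top (Measurable.tsum fun j => hΦm (j + J)) hsum
  have hae' : ∀ᵐ x ∂μ.restrict (ball x₀ ρ), Tendsto (fun j => Φ j x) atTop (𝓝 0) := by
    filter_upwards [hae] with x hx
    exact (tendsto_add_atTop_iff_nat J).1 (ENNReal.tendsto_atTop_zero_of_tsum_ne_top hx.ne)
  rw [ae_restrict_iff' measurableSet_ball, ae_iff] at hae'
  refine measure_mono_null ?_ hae'
  rintro x ⟨hx, hxb⟩ h
  exact hx fun _ => h hxb

/-- The previous decay at arbitrary small scales `ρ`: each of them is close to one of the countably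
many scales of a geometric sequence with ratio close to `1`. -/
theorem ae_exists_scale {X : Type u} [MetricSpace X] [ProperSpace X]
    [MeasurableSpace X] [BorelSpace X] {μ : Measure X} (hμ : IsMetricMeasure μ)
    (hdoubling : IsLocallyDoubling μ) {Ω : Set X} (hΩ : IsOpen Ω) {F : X → ℝ} (hF : Measurable F)
    (hdefect : ∀ K : Set X, IsCompact K → K ⊆ Ω → ∃ M : ℝ≥0∞, M ≠ ∞ ∧ ∀ᶠ r in 𝓝[>] (0 : ℝ),
      ∫⁻ y in K, ‖(⨍ b in ball y r, F b ∂μ) - F y‖ₑ ∂μ ≤ M * ENNReal.ofReal (r ^ 2)) :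
    ∀ᵐ x ∂μ, x ∈ Ω → ∀ q T : ℝ, q < 1 → ∃ T₁ : ℝ, ∀ ε : ℝ≥0∞, ε ≠ 0 → ∃ ρ₀ : ℝ, 0 < ρ₀ ∧
      ∀ ρ : ℝ, 0 < ρ → ρ < ρ₀ → ∃ s : ℝ, q * ρ ≤ s ∧ s ≤ ρ ∧ 0 < s ∧
        ∫⁻ y in ball x (T * ρ), ‖(⨍ b in ball y s, F b ∂μ) - F y‖ₑ ∂μ ≤
          ε * (ENNReal.ofReal ρ * μ (ball x (T₁ * ρ))) := by
  have hae : ∀ᵐ x ∂μ, ∀ i n : ℕ, x ∈ Ω → Tendsto (fun j : ℕ =>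
      (ENNReal.ofReal ((1 - 1 / ((i : ℝ) + 2)) ^ j))⁻¹ *
        ((μ (ball x (((n : ℝ) + 1) * (1 - 1 / ((i : ℝ) + 2)) ^ j)))⁻¹ *
          ∫⁻ y in ball x (((n : ℝ) + 1) * (1 - 1 / ((i : ℝ) + 2)) ^ j),
            ‖(⨍ b in ball y ((1 - 1 / ((i : ℝ) + 2)) ^ j), F b ∂μ) - F y‖ₑ ∂μ)) atTop (𝓝 0) := by
    refine ae_all_iff.2 fun i => ae_all_iff.2 fun n => ?_
    have h2 : (0 : ℝ) < (i : ℝ) + 2 := by positivity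
    exact ae_tendsto_average_defect hμ hdoubling hΩ hF hdefect
      (sub_pos.2 ((div_lt_one h2).2 (by linarith [(Nat.cast_nonneg i : (0 : ℝ) ≤ i)])))
      (by linarith [div_pos one_pos h2]) (by positivity)
  filter_upwards [hae] with x hx hxΩ q T hq
  obtain ⟨i, hi⟩ := exists_nat_one_div_lt (sub_pos.2 hq)
  set q' : ℝ := 1 - 1 / ((i : ℝ) + 2) with hq'
  have hi1 : 1 / ((i : ℝ) + 2) ≤ 1 / ((i : ℝ) + 1) :=
    one_div_le_one_div_of_le (by positivity) (by linarith)
  have hqq' : q ≤ q' := by linarith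
  have hq'0 : 0 < q' :=
    sub_pos.2 ((div_lt_one (by positivity)).2 (by linarith [(Nat.cast_nonneg i : (0 : ℝ) ≤ i)]))
  have hq'1 : q' < 1 := by
    have : (0 : ℝ) < 1 / ((i : ℝ) + 2) := by positivity
    linarith
  obtain ⟨n, hn⟩ := exists_nat_ge (T / q')
  have hnT : T ≤ ((n : ℝ) + 1) * q' := by
    rw [div_le_iff₀ hq'0] at hn
    linarith
  refine ⟨(n : ℝ) + 1, fun ε hε => ?_⟩
  obtain ⟨J, hJ⟩ := eventually_atTop.1 ((hx i n hxΩ).eventually (gt_mem_nhds (pos_iff_ne_zero.2 hε)))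
  refine ⟨q' ^ J, pow_pos hq'0 J, fun ρ hρ hρJ => ?_⟩
  obtain ⟨j, hj1, hj2⟩ := exists_nat_pow_near_of_lt_one hρ
    (hρJ.le.trans (pow_le_one₀ hq'0.le hq'1.le)) hq'0 hq'1
  have hJj : J ≤ j + 1 :=
    ((pow_lt_pow_iff_right_of_lt_one₀ hq'0 hq'1).1 (hj1.trans hρJ)).le
  have hqs : q' * ρ ≤ q' ^ (j + 1) := by
    rw [pow_succ']
    gcongr
  have hs0 : 0 < q' ^ (j + 1) := pow_pos hq'0 _
  have h := (hJ (j + 1) hJj).le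
  set s := q' ^ (j + 1)
  refine ⟨s, (mul_le_mul_of_nonneg_right hqq' hρ.le).trans hqs, hj1.le, hs0, ?_⟩
  have hballpos := (hμ.ball_pos x (((n : ℝ) + 1) * s) (by positivity)).ne'
  have hballtop := (hμ.ball_lt_top x (((n : ℝ) + 1) * s)).ne
  rw [← mul_assoc, ← ENNReal.mul_inv (Or.inr hballtop) (Or.inr hballpos), mul_comm,
    ← div_eq_mul_inv, ENNReal.div_le_iff_le_mul
      (Or.inl (mul_ne_zero (by simpa using hs0) hballpos))
      (Or.inl (ENNReal.mul_ne_top ENNReal.ofReal_ne_top hballtop))] at h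
  calc _ ≤ ∫⁻ y in ball x (((n : ℝ) + 1) * s), ‖(⨍ b in ball y s, F b ∂μ) - F y‖ₑ ∂μ := by
        refine lintegral_mono_set (ball_subset_ball ?_)
        calc T * ρ ≤ (((n : ℝ) + 1) * q') * ρ := by gcongr
          _ = ((n : ℝ) + 1) * (q' * ρ) := by ring
          _ ≤ _ := by gcongr
    _ ≤ _ := h
    _ ≤ _ := by
        gcongr

/-! ### Weak convergence of double integrals -/

/-- The functions `g m` on the spaces `(X, μ m)` are bounded in `L¹` on the preimages under `ι m` of
each ball about `q`, uniformly for large `m`. -/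
def EventuallyLocallyBounded {X : Type u} [MeasurableSpace X] {Z : Type w} [MetricSpace Z]
    (ι : ℕ → X → Z) (μ : ℕ → Measure X) (q : Z) (g : ℕ → X → ℝ) : Prop :=
  ∀ R : ℝ, ∃ C : ℝ, 0 ≤ C ∧ ∀ᶠ m in atTop, IntegrableOn (g m) (ι m ⁻¹' ball q R) (μ m) ∧
    ∫ a in ι m ⁻¹' ball q R, |g m a| ∂(μ m) ≤ C

section

variable {X : Type u} [MeasurableSpace X] {Y : Type v} [MeasurableSpace Y] {Z : Type w}
  [MetricSpace Z]
  {ι : ℕ → X → Z} {j : Y → Z} {μ : ℕ → Measure X} {ν : Measure Y} {q : Z}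
  {g h : ℕ → X → ℝ} {g' h' : Y → ℝ}

theorem exists_abs_le_of_support_subset_ball [ProperSpace Z] {φ : Z → ℝ} (hφ : Continuous φ) {T : ℝ}
    (hT : Function.support φ ⊆ ball q T) : ∃ B : ℝ, 0 ≤ B ∧ ∀ z, |φ z| ≤ B := by
  obtain ⟨B, hB⟩ := (isCompact_closedBall q T).exists_bound_of_continuousOn hφ.continuousOn
  refine ⟨max B 0, le_max_right _ _, fun z => ?_⟩
  by_cases hz : φ z = 0
  · simp [hz]
  · exact (hB z (ball_subset_closedBall (hT hz))).trans (le_max_left _ _)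

theorem integrable_comp_mul [MeasurableSpace Z] [OpensMeasurableSpace Z] {Φ : Z → ℝ}
    (hΦ : Measurable Φ) {B T : ℝ} (hB : ∀ z, |Φ z| ≤ B)
    (hT : Function.support Φ ⊆ ball q T) {i : X → Z} (hi : Measurable i) {μ : Measure X}
    {g : X → ℝ} (hg : IntegrableOn g (i ⁻¹' ball q T) μ) :
    Integrable (fun a => Φ (i a) * g a) μ := by
  have h1 : Integrable ((i ⁻¹' ball q T).indicator g) μ :=
    hg.integrable_indicator (hi measurableSet_ball)
  refine (h1.bdd_mul (c := B) (hΦ.comp hi).aestronglyMeasurable (ae_of_all _ fun a => hB _)).congr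
    (ae_of_all _ fun a => ?_)
  by_cases ha : i a ∈ ball q T
  · simp [indicator, ha]
  · have : Φ (i a) = 0 := by by_contra h; exact ha (hT h)
    simp [this]

variable {η : ℝ → ℝ} {L : ℝ≥0} {R : ℝ}

theorem PushforwardsConvergeWeakly.tendsto_kernel
    (hw : PushforwardsConvergeWeakly ι j μ ν g g') (hη : LipschitzWith L η)
    (hηR : ∀ t, R ≤ t → η t = 0) (z : Z) :
    Tendsto (fun m => ∫ b, η (dist z (ι m b)) * g m b ∂(μ m)) atTop
      (𝓝 (∫ b, η (dist z (j b)) * g' b ∂ν)) :=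
  hw (fun y => η (dist z y)) (hη.continuous.comp (continuous_const.dist continuous_id))
    ((isBounded_ball (x := z) (r := R)).subset fun y hy => by
      rw [mem_ball, dist_comm]
      by_contra h
      exact hy (hηR _ (not_lt.1 h)))

variable [MeasurableSpace Z] [BorelSpace Z]

/-- The potentials of the measures `g m · μ m` with a Lipschitz kernel of finite range are
equi-Lipschitz on balls. -/
theorem abs_integral_kernel_sub_le {i : X → Z} (hi : Measurable i) {μ : Measure X} {g : X → ℝ}
    (hη : LipschitzWith L η) {T : ℝ} (hηR : ∀ t, R ≤ t → η t = 0)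
    (hη1 : ∀ t, |η t| ≤ 1) (hg : IntegrableOn g (i ⁻¹' ball q (T + R)) μ) {z z' : Z}
    (hz : z ∈ closedBall q T) (hz' : z' ∈ closedBall q T) :
    |(∫ b, η (dist z (i b)) * g b ∂μ) - ∫ b, η (dist z' (i b)) * g b ∂μ| ≤
      L * dist z z' * ∫ b in i ⁻¹' ball q (T + R), |g b| ∂μ := by
  have hzero : ∀ z ∈ closedBall q T, ∀ b, b ∉ i ⁻¹' ball q (T + R) →
      η (dist z (i b)) * g b = 0 := fun z hz b hb => by
    rw [mem_preimage, mem_ball, not_lt] at hb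
    rw [mem_closedBall] at hz
    rw [hηR _ (by linarith [dist_triangle (i b) z q, dist_comm z (i b)]), zero_mul]
  have hint : ∀ z, IntegrableOn (fun b => η (dist z (i b)) * g b) (i ⁻¹' ball q (T + R)) μ :=
    fun z => hg.bdd_mul (c := 1)
      ((hη.continuous.comp (continuous_const.dist continuous_id)).measurable.comp
        hi).aestronglyMeasurable
      (ae_of_all _ fun b => hη1 _)
  rw [← setIntegral_eq_integral_of_forall_compl_eq_zero (hzero z hz),
    ← setIntegral_eq_integral_of_forall_compl_eq_zero (hzero z' hz'),
    ← integral_sub (hint z) (hint z'), ← integral_const_mul, ← Real.norm_eq_abs]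
  refine norm_integral_le_of_norm_le (hg.abs.const_mul _) (ae_of_all _ fun b => ?_)
  rw [← sub_mul, norm_mul, Real.norm_eq_abs, Real.norm_eq_abs]
  gcongr
  have h1 := hη.dist_le_mul (dist z (i b)) (dist z' (i b))
  rw [Real.dist_eq, Real.dist_eq] at h1
  exact h1.trans (by gcongr; exact abs_dist_sub_le z z' (i b))

theorem PushforwardsConvergeWeakly.abs_kernel_lim_sub_le (hι : ∀ m, Measurable (ι m))
    (hw : PushforwardsConvergeWeakly ι j μ ν g g') (hb : EventuallyLocallyBounded ι μ q g)
    (hη : LipschitzWith L η) (hηR : ∀ t, R ≤ t → η t = 0) (hη1 : ∀ t, |η t| ≤ 1) (T : ℝ) :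
    ∃ C : ℝ, 0 ≤ C ∧ (∀ z ∈ closedBall q T, ∀ z' ∈ closedBall q T,
      |(∫ b, η (dist z (j b)) * g' b ∂ν) - ∫ b, η (dist z' (j b)) * g' b ∂ν| ≤ C * dist z z') ∧
      ∀ᶠ m in atTop, ∀ z ∈ closedBall q T, ∀ z' ∈ closedBall q T,
        |(∫ b, η (dist z (ι m b)) * g m b ∂(μ m)) - ∫ b, η (dist z' (ι m b)) * g m b ∂(μ m)| ≤
          C * dist z z' := by
  obtain ⟨C, hC0, hC⟩ := hb (T + R)
  have hev : ∀ᶠ m in atTop, ∀ z ∈ closedBall q T, ∀ z' ∈ closedBall q T,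
        |(∫ b, η (dist z (ι m b)) * g m b ∂(μ m)) - ∫ b, η (dist z' (ι m b)) * g m b ∂(μ m)| ≤
          (L * C) * dist z z' := by
    filter_upwards [hC] with m ⟨hm1, hm2⟩ z hz z' hz'
    calc _ ≤ _ := abs_integral_kernel_sub_le (hι m) hη hηR hη1 hm1 hz hz'
      _ ≤ L * dist z z' * C := by gcongr
      _ = _ := by ring
  refine ⟨L * C, by positivity, fun z hz z' hz' => ?_, hev⟩
  exact le_of_tendsto ((hw.tendsto_kernel hη hηR z).sub (hw.tendsto_kernel hη hηR z')).abs
    (hev.mono fun m hm => hm z hz z' hz')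

theorem PushforwardsConvergeWeakly.continuous_kernel_lim (hι : ∀ m, Measurable (ι m))
    (hw : PushforwardsConvergeWeakly ι j μ ν g g') (hb : EventuallyLocallyBounded ι μ q g)
    (hη : LipschitzWith L η) (hηR : ∀ t, R ≤ t → η t = 0) (hη1 : ∀ t, |η t| ≤ 1) :
    Continuous fun z => ∫ b, η (dist z (j b)) * g' b ∂ν := by
  rw [continuous_iff_continuousAt]
  intro z
  obtain ⟨C, hC0, hC, -⟩ := hw.abs_kernel_lim_sub_le hι hb hη hηR hη1 (dist z q + 1)
  have hLip : LipschitzOnWith C.toNNReal (fun z => ∫ b, η (dist z (j b)) * g' b ∂ν)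
      (closedBall q (dist z q + 1)) := by
    refine LipschitzOnWith.of_dist_le_mul fun x hx y hy => ?_
    rw [Real.coe_toNNReal _ hC0]
    exact hC x hx y hy
  exact hLip.continuousOn.continuousAt
    (mem_of_superset (isOpen_ball.mem_nhds (by simp)) ball_subset_closedBall)

variable [ProperSpace Z]

/-- Weak convergence may be tested with uniformly convergent sequences of test functions. -/
theorem PushforwardsConvergeWeakly.tendsto_integral (hι : ∀ m, Measurable (ι m))
    (hw : PushforwardsConvergeWeakly ι j μ ν g g') (hb : EventuallyLocallyBounded ι μ q g)
    {Φ : ℕ → Z → ℝ} {Φ' : Z → ℝ} (hΦ : ∀ m, Measurable (Φ m)) (hΦ' : Continuous Φ') {T : ℝ}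
    (hT : ∀ m, Function.support (Φ m) ⊆ ball q T) (hT' : Function.support Φ' ⊆ ball q T)
    (hunif : ∀ ε > 0, ∀ᶠ m in atTop, ∀ z, |Φ m z - Φ' z| ≤ ε) :
    Tendsto (fun m => ∫ a, Φ m (ι m a) * g m a ∂(μ m)) atTop (𝓝 (∫ b, Φ' (j b) * g' b ∂ν)) := by
  have h1 := hw Φ' hΦ' (isBounded_ball.subset hT')
  obtain ⟨C, hC0, hC⟩ := hb T
  obtain ⟨B, hB0, hB⟩ := exists_abs_le_of_support_subset_ball hΦ' hT'
  have h2 : Tendsto (fun m => ∫ a, Φ m (ι m a) * g m a ∂(μ m) - ∫ a, Φ' (ι m a) * g m a ∂(μ m))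
      atTop (𝓝 0) := by
    rw [Metric.tendsto_nhds]
    intro ε hε
    filter_upwards [hC, hunif (ε / (C + 1)) (by positivity)] with m ⟨hm1, hm2⟩ hm3
    rw [← integral_sub (integrable_comp_mul (hΦ m) (B := B + ε / (C + 1)) (fun z => by
        have := abs_add_le (Φ m z - Φ' z) (Φ' z)
        rw [sub_add_cancel] at this
        linarith [hm3 z, hB z]) (hT m) (hι m) hm1)
      (integrable_comp_mul hΦ'.measurable hB hT' (hι m) hm1), dist_zero_right]
    have hsupp : ∀ a, a ∉ ι m ⁻¹' ball q T →
        Φ m (ι m a) * g m a - Φ' (ι m a) * g m a = 0 := fun a ha => by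
      have h3 : Φ m (ι m a) = 0 := by by_contra h; exact ha (hT m h)
      have h4 : Φ' (ι m a) = 0 := by by_contra h; exact ha (hT' h)
      rw [h3, h4]; ring
    rw [← setIntegral_eq_integral_of_forall_compl_eq_zero hsupp]
    calc _ ≤ ∫ a in ι m ⁻¹' ball q T, ε / (C + 1) * |g m a| ∂(μ m) := by
          refine norm_integral_le_of_norm_le (hm1.abs.const_mul _) (ae_of_all _ fun a => ?_)
          rw [← sub_mul, norm_mul, Real.norm_eq_abs, Real.norm_eq_abs]
          gcongr
          exact hm3 _
      _ = ε / (C + 1) * ∫ a in ι m ⁻¹' ball q T, |g m a| ∂(μ m) := integral_const_mul _ _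
      _ ≤ ε / (C + 1) * C := by gcongr
      _ < ε := by
          rw [div_mul_eq_mul_div, div_lt_iff₀ (by positivity)]
          nlinarith
  simpa using h2.add h1

/-- The potentials converge locally uniformly. -/
theorem PushforwardsConvergeWeakly.eventually_abs_kernel_sub_le (hι : ∀ m, Measurable (ι m))
    (hw : PushforwardsConvergeWeakly ι j μ ν g g') (hb : EventuallyLocallyBounded ι μ q g)
    (hη : LipschitzWith L η) (hηR : ∀ t, R ≤ t → η t = 0) (hη1 : ∀ t, |η t| ≤ 1) (T : ℝ) {ε : ℝ}
    (hε : 0 < ε) :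
    ∀ᶠ m in atTop, ∀ z ∈ closedBall q T,
      |(∫ b, η (dist z (ι m b)) * g m b ∂(μ m)) - ∫ b, η (dist z (j b)) * g' b ∂ν| ≤ ε := by
  obtain ⟨C, hC0, hC, hCev⟩ := hw.abs_kernel_lim_sub_le hι hb hη hηR hη1 T
  obtain ⟨S, hST, hSfin, hScov⟩ := (isCompact_closedBall q T).finite_cover_balls
    (show 0 < ε / (3 * (C + 1)) by positivity)
  have hfin : ∀ᶠ m in atTop, ∀ c ∈ S,
      |(∫ b, η (dist c (ι m b)) * g m b ∂(μ m)) - ∫ b, η (dist c (j b)) * g' b ∂ν| < ε / 3 :=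
    (eventually_all_finite hSfin).2 fun c _ =>
      (Metric.tendsto_nhds.1 (hw.tendsto_kernel hη hηR c)) _ (by positivity)
  filter_upwards [hCev, hfin] with m hm1 hm2 z hz
  obtain ⟨c, hcS, hc⟩ := mem_iUnion₂.1 (hScov hz)
  have hd : C * dist z c ≤ ε / 3 := by
    calc C * dist z c ≤ C * (ε / (3 * (C + 1))) := by
          gcongr
          exact (mem_ball.1 hc).le
      _ ≤ (C + 1) * (ε / (3 * (C + 1))) := by gcongr; linarith
      _ = ε / 3 := by field_simp
  have h1 := (hm1 z hz c (hST hcS)).trans hd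
  have h2 := (hC z hz c (hST hcS)).trans hd
  have h3 := hm2 c hcS
  rw [abs_le] at h1 h2 ⊢
  rw [abs_lt] at h3
  constructor <;> linarith [h1.1, h1.2, h2.1, h2.2, h3.1, h3.2]

/-- Double integrals with a Lipschitz kernel of finite range pass to the weak limit in both factors.
The inner integrals, multiplied by `φ`, are uniformly convergent test functions for the outer
ones. -/
theorem tendsto_double_integral [∀ m, SFinite (μ m)] (hι : ∀ m, Measurable (ι m))
    (hg : ∀ m, Measurable (g m)) (hwg : PushforwardsConvergeWeakly ι j μ ν g g')
    (hbg : EventuallyLocallyBounded ι μ q g) (hwh : PushforwardsConvergeWeakly ι j μ ν h h')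
    (hbh : EventuallyLocallyBounded ι μ q h) (hη : LipschitzWith L η)
    (hηR : ∀ t, R ≤ t → η t = 0) (hη1 : ∀ t, |η t| ≤ 1) {φ : Z → ℝ} (hφ : Continuous φ) {T : ℝ}
    (hT : Function.support φ ⊆ ball q T) :
    Tendsto (fun m => ∫ a, φ (ι m a) * (∫ b, η (dist (ι m a) (ι m b)) * g m b ∂(μ m)) * h m a
      ∂(μ m)) atTop
      (𝓝 (∫ y, φ (j y) * (∫ b, η (dist (j y) (j b)) * g' b ∂ν) * h' y ∂ν)) := by
  obtain ⟨B, hB0, hB⟩ := exists_abs_le_of_support_subset_ball hφ hT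
  have hsupp : ∀ V : Z → ℝ, Function.support (fun z => φ z * V z) ⊆ ball q T := fun V z hz =>
    hT fun h => hz (by simp only [h, zero_mul])
  refine hwh.tendsto_integral hι hbh
    (Φ := fun m z => φ z * ∫ b, η (dist z (ι m b)) * g m b ∂(μ m))
    (Φ' := fun z => φ z * ∫ b, η (dist z (j b)) * g' b ∂ν) (fun m => ?_)
    (hφ.mul (hwg.continuous_kernel_lim hι hbg hη hηR hη1)) (T := T) (fun m => hsupp _) (hsupp _)
    fun ε hε => ?_
  · have hm : Measurable fun p : Z × X => η (dist p.1 (ι m p.2)) * g m p.2 :=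
      (hη.continuous.measurable.comp
        (measurable_fst.dist ((hι m).comp measurable_snd))).mul ((hg m).comp measurable_snd)
    exact hφ.measurable.mul (hm.stronglyMeasurable.integral_prod_right' (ν := μ m)).measurable
  · filter_upwards [hwg.eventually_abs_kernel_sub_le hι hbg hη hηR hη1 T
      (show 0 < ε / (B + 1) by positivity)] with m hm z
    rw [← mul_sub, abs_mul]
    by_cases hz : φ z = 0
    · simp [hz, hε.le]
    · calc _ ≤ B * (ε / (B + 1)) := by
            gcongr
            · exact hB z
            · exact hm z (ball_subset_closedBall (hT hz))
        _ ≤ (B + 1) * (ε / (B + 1)) := by gcongr; linarith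
        _ = ε := by field_simp

end

/-! ### Mean value harmonic representatives -/

section

variable {Y : Type v} [MetricSpace Y] [ProperSpace Y] [MeasurableSpace Y] [BorelSpace Y]
  {ν : Measure Y}

theorem continuous_setIntegral_ball {u : Y → ℝ} (hu : LocallyIntegrable u ν) {R : ℝ}
    (hsphere : ∀ y, ν (sphere y R) = 0) : Continuous fun y => ∫ b in ball y R, u b ∂ν := by
  have hballint : ∀ y r, IntegrableOn u (ball y r) ν := fun y r =>
    (hu.integrableOn_isCompact (isCompact_closedBall y r)).mono_set ball_subset_closedBall
  rw [continuous_iff_continuousAt]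
  intro y₀
  simp_rw [← integral_indicator measurableSet_ball]
  refine continuousAt_of_dominated (bound := (ball y₀ (R + 1)).indicator fun b => ‖u b‖)
    (Eventually.of_forall fun y =>
      ((hballint y R).integrable_indicator measurableSet_ball).aestronglyMeasurable) ?_
    (IntegrableOn.integrable_indicator (hballint y₀ (R + 1)).norm measurableSet_ball) ?_
  · filter_upwards [ball_mem_nhds y₀ one_pos] with y hy
    refine ae_of_all _ fun b => ?_
    rw [norm_indicator_eq_indicator_norm]
    refine indicator_le_indicator_of_subset (fun b hb => ?_) (fun _ => norm_nonneg _) b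
    rw [mem_ball] at *
    linarith [dist_triangle b y y₀]
  · have : ∀ᵐ b ∂ν, b ∉ sphere y₀ R := measure_eq_zero_iff_ae_notMem.1 (hsphere y₀)
    filter_upwards [this] with b hb
    have hcont : Continuous fun y => dist b y := continuous_const.dist continuous_id
    rcases lt_or_gt_of_ne (show dist b y₀ ≠ R from hb) with h | h
    · refine (continuousAt_const (y := u b)).congr ?_
      filter_upwards [hcont.continuousAt.eventually (gt_mem_nhds h)] with y hy
      rw [indicator_of_mem (mem_ball.2 hy)]
    · refine (continuousAt_const (y := (0 : ℝ))).congr ?_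
      filter_upwards [hcont.continuousAt.eventually (lt_mem_nhds h)] with y hy
      rw [indicator_of_notMem (by simpa using hy.le)]

theorem locallyIntegrable_ball_defect (hν : IsMetricMeasure ν) {u : Y → ℝ}
    (hu : LocallyIntegrable u ν) {R : ℝ} (hsphere : ∀ y, ν (sphere y R) = 0) :
    LocallyIntegrable (fun y => (∫ b in ball y R, u b ∂ν) - ν.real (ball y R) * u y) ν := by
  have := hν.isLocallyFiniteMeasure
  have hreal : Continuous fun y => ν.real (ball y R) := by
    simpa using continuous_setIntegral_ball (locallyIntegrable_const (1 : ℝ) (μ := ν)) hsphere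
  exact (continuous_setIntegral_ball hu hsphere).locallyIntegrable.sub (hu.continuous_mul hreal)

/-- A locally integrable function which has the mean value property for every radius at almost every
point agrees almost everywhere with a mean value harmonic function, namely with its averages over
the balls of radius one: when spheres are null sets, all averages are continuous. -/
theorem exists_isMeanValueHarmonic (hν : IsMetricMeasure ν) {u : Y → ℝ}
    (hu : LocallyIntegrable u ν) (hsphere : ∀ y R, 0 < R → ν (sphere y R) = 0)
    (hmean : ∀ R, 0 < R → ∀ K : Set Y, IsCompact K →
      ∫ y in K, ((∫ b in ball y R, u b ∂ν) - ν.real (ball y R) * u y) ∂ν = 0) :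
    ∃ h : Y → ℝ, h =ᵐ[ν] u ∧ IsMeanValueHarmonic ν h := by
  have := hν.isLocallyFiniteMeasure
  have := hν.isOpenPosMeasure
  have hreal : ∀ y r, 0 < r → 0 < ν.real (ball y r) := fun y r hr =>
    ENNReal.toReal_pos (hν.ball_pos y r hr).ne' (hν.ball_lt_top y r).ne
  have hcreal : ∀ R, 0 < R → Continuous fun y => ν.real (ball y R) := fun R hR => by
    simpa using continuous_setIntegral_ball (locallyIntegrable_const (1 : ℝ) (μ := ν))
      fun y => hsphere y R hR
  have hcont : ∀ R, 0 < R → Continuous fun y => ⨍ b in ball y R, u b ∂ν := fun R hR => by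
    simp_rw [setAverage_eq, smul_eq_mul]
    exact ((hcreal R hR).inv₀ fun y => (hreal y R hR).ne').mul
      (continuous_setIntegral_ball hu fun y => hsphere y R hR)
  have hae : ∀ R, 0 < R → (fun y => ⨍ b in ball y R, u b ∂ν) =ᵐ[ν] u := fun R hR => by
    filter_upwards [ae_eq_zero_of_forall_setIntegral_isCompact_eq_zero'
      (locallyIntegrable_ball_defect hν hu fun y => hsphere y R hR) (hmean R hR)] with y hy
    rw [setAverage_eq, smul_eq_mul, inv_mul_eq_iff_eq_mul₀ (hreal y R hR).ne']
    exact sub_eq_zero.1 hy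
  refine ⟨fun y => ⨍ b in ball y 1, u b ∂ν, hae 1 one_pos,
    (hcont 1 one_pos).locallyIntegrable, fun K hK r ρ hr hrρ _ x hx => ?_⟩
  have heq : (fun y => ⨍ b in ball y r, u b ∂ν) = fun y => ⨍ b in ball y 1, u b ∂ν :=
    (Continuous.ae_eq_iff_eq ν (hcont r hr) (hcont 1 one_pos)).1
      ((hae r hr).trans (hae 1 one_pos).symm)
  have h1 : ⨍ y in ball x r, (⨍ b in ball y 1, u b ∂ν) ∂ν = ⨍ b in ball x r, u b ∂ν :=
    setAverage_congr_fun measurableSet_ball ((hae 1 one_pos).mono fun y hy _ => hy)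
  rw [rLaplacian, h1, congrFun heq x, sub_self, zero_div]

end

/-! ### The mean value defect with a continuous kernel -/

/-- A continuous replacement of the indicator function of `(-∞, R)`: it equals `1` up to
`(1 - δ) * R`, vanishes from `R` on, and is affine in between. -/
noncomputable def cutoff (R δ t : ℝ) : ℝ :=
  max 0 (min 1 ((R - t) / (δ * R)))

theorem cutoff_nonneg (R δ t : ℝ) : 0 ≤ cutoff R δ t := le_max_left _ _

theorem cutoff_le_one (R δ t : ℝ) : cutoff R δ t ≤ 1 := max_le zero_le_one (min_le_left _ _)

theorem abs_cutoff_le_one (R δ t : ℝ) : |cutoff R δ t| ≤ 1 := by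
  rw [abs_of_nonneg (cutoff_nonneg R δ t)]
  exact cutoff_le_one R δ t

theorem cutoff_eq_zero {R δ t : ℝ} (hR : 0 < R) (hδ : 0 < δ) (ht : R ≤ t) : cutoff R δ t = 0 :=
  max_eq_left ((min_le_right _ _).trans (div_nonpos_of_nonpos_of_nonneg (by linarith)
    (by positivity)))

theorem cutoff_eq_one {R δ t : ℝ} (hR : 0 < R) (hδ : 0 < δ) (ht : t ≤ (1 - δ) * R) :
    cutoff R δ t = 1 := by
  have : 1 ≤ (R - t) / (δ * R) := by
    rw [le_div_iff₀ (by positivity)]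
    linarith
  rw [cutoff, min_eq_left this, max_eq_right zero_le_one]

theorem lipschitzWith_cutoff (R δ : ℝ) : LipschitzWith (Real.nnabs (δ * R)⁻¹) (cutoff R δ) := by
  have h1 : LipschitzWith (Real.nnabs (δ * R)⁻¹) fun t : ℝ => (R - t) / (δ * R) := by
    refine LipschitzWith.of_dist_le_mul fun t t' => le_of_eq ?_
    rw [Real.dist_eq, Real.dist_eq, ← sub_div, div_eq_mul_inv, abs_mul, mul_comm, Real.coe_nnabs]
    congr 1
    rw [abs_sub_comm]
    congr 1
    ring
  exact (h1.const_min 1).const_max 0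

section

variable {X : Type u} [MetricSpace X] [ProperSpace X] [MeasurableSpace X] [BorelSpace X]

/-- Comparison of a kernel `k` with the kernel of averages over balls of radius `σ`: if both differ
only on an annulus, then so do the mean value defects, up to the measure of annuli times the
`L¹` norm of the function. -/
theorem lintegral_kernel_defect_le {μ : Measure X} (hμ : IsMetricMeasure μ) {v : X → ℝ}
    (hv : Measurable v) {k : X → X → ℝ} (hk : Measurable (Function.uncurry k)) {l σ ρ t : ℝ}
    (hσ : 0 < σ) (hσρ : σ ≤ ρ)
    (hkσ : ∀ a b, |k a b - (ball a σ).indicator (fun _ => 1) b| ≤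
      {b | l ≤ dist a b ∧ dist a b < ρ}.indicator (fun _ => 1) b)
    {x : X} (hint : IntegrableOn v (ball x (t + ρ)) μ) {κ : ℝ≥0∞}
    (hκ : ∀ a ∈ ball x (t + ρ), μ {b | l ≤ dist a b ∧ dist a b < ρ} ≤ κ) :
    ∫⁻ a in ball x t, ‖∫ b, k a b * (v b - v a) ∂μ‖ₑ ∂μ ≤
      ∫⁻ a in ball x t, μ (ball a σ) * ‖(⨍ b in ball a σ, v b ∂μ) - v a‖ₑ ∂μ +
        κ * (2 * ∫⁻ a in ball x (t + ρ), ‖v a‖ₑ ∂μ) := by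
  have := hμ.isLocallyFiniteMeasure
  have hρ : 0 < ρ := hσ.trans_le hσρ
  set A : X → Set X := fun a => {b | l ≤ dist a b ∧ dist a b < ρ} with hA
  have hAm : MeasurableSet {p : X × X | l ≤ dist p.1 p.2 ∧ dist p.1 p.2 < ρ} :=
    (measurableSet_Ico (a := l) (b := ρ)).preimage
      (continuous_fst.dist continuous_snd : Continuous fun p : X × X => dist p.1 p.2).measurable
  have hAm' : ∀ a, MeasurableSet (A a) := fun a => measurable_prodMk_left hAm
  have hAsymm : ∀ a b, b ∈ A a ↔ a ∈ A b := fun a b => by simp only [hA, mem_ofPred_eq, dist_comm]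
  have hAball : ∀ a b, b ∈ A a → a ∈ ball x t → b ∈ ball x (t + ρ) := fun a b hb ha => by
    rw [mem_ball] at *
    have := hb.2
    linarith [dist_triangle b a x, dist_comm a b]
  have hpt : ∀ a ∈ ball x t, ‖∫ b, k a b * (v b - v a) ∂μ‖ₑ ≤
      μ (ball a σ) * ‖(⨍ b in ball a σ, v b ∂μ) - v a‖ₑ +
        (∫⁻ b, (A a).indicator (fun b => ‖v b‖ₑ) b ∂μ + ‖v a‖ₑ * μ (A a)) := by
    intro a ha
    have hsub : ∀ r ≤ ρ, ball a r ⊆ ball x (t + ρ) := fun r hr b hb => by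
      rw [mem_ball] at *
      linarith [dist_triangle b a x]
    have hi0 : IntegrableOn (fun b => v b - v a) (ball a ρ) μ :=
      (hint.mono_set (hsub ρ le_rfl)).sub (integrableOn_const (hμ.ball_lt_top a ρ).ne)
    have hi1 : Integrable ((ball a ρ).indicator fun b => v b - v a) μ :=
      hi0.integrable_indicator measurableSet_ball
    have hi2 : Integrable ((ball a σ).indicator fun b => v b - v a) μ :=
      (hi0.mono_set (ball_subset_ball hσρ)).integrable_indicator measurableSet_ball
    have hkm : Measurable (k a) := hk.comp measurable_prodMk_left
    have hd1 : ∀ b, |k a b - (ball a σ).indicator (fun _ => 1) b| ≤ 1 := fun b =>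
      (hkσ a b).trans (indicator_le' (fun _ _ => le_rfl) (fun _ _ => zero_le_one) b)
    have hi3 : Integrable (fun b => (k a b - (ball a σ).indicator (fun _ => 1) b) *
        (v b - v a)) μ := by
      refine (hi1.bdd_mul (c := 1) (hkm.sub (measurable_const.indicator
        measurableSet_ball)).aestronglyMeasurable (ae_of_all _ hd1)).congr (ae_of_all _ fun b => ?_)
      by_cases hb : b ∈ ball a ρ
      · simp only [indicator_of_mem hb, Pi.sub_apply]
      · have h0 : k a b - (ball a σ).indicator (fun _ => 1) b = 0 := by
          have := hkσ a b
          rw [indicator_of_notMem (s := {b | l ≤ dist a b ∧ dist a b < ρ})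
            (fun h => hb (by rw [mem_ball, dist_comm]; exact h.2))] at this
          exact abs_nonpos_iff.1 this
        simp only [Pi.sub_apply, h0, zero_mul]
    have hsplit : ∫ b, k a b * (v b - v a) ∂μ = ∫ b in ball a σ, (v b - v a) ∂μ +
        ∫ b, (k a b - (ball a σ).indicator (fun _ => 1) b) * (v b - v a) ∂μ := by
      rw [← integral_indicator measurableSet_ball, ← integral_add hi2 hi3]
      refine integral_congr_ae (ae_of_all _ fun b => ?_)
      by_cases hb : b ∈ ball a σ
      · simp [indicator_of_mem hb]; ring
      · simp [indicator_of_notMem hb]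
    rw [hsplit]
    refine (enorm_add_le _ _).trans (add_le_add (le_of_eq ?_) ?_)
    · have h1 : ∫ b in ball a σ, (v b - v a) ∂μ =
          μ.real (ball a σ) * ((⨍ b in ball a σ, v b ∂μ) - v a) := by
        have hne : μ.real (ball a σ) ≠ 0 :=
          (ENNReal.toReal_pos (hμ.ball_pos a σ hσ).ne' (hμ.ball_lt_top a σ).ne).ne'
        rw [integral_sub (hint.mono_set (hsub σ hσρ)) (integrableOn_const (hμ.ball_lt_top a σ).ne),
          setIntegral_const, setAverage_eq, smul_eq_mul, smul_eq_mul]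
        field_simp
      rw [h1, enorm_mul, Real.enorm_eq_ofReal measureReal_nonneg,
        ofReal_measureReal (hμ.ball_lt_top a σ).ne]
    · calc _ ≤ ∫⁻ b, ‖(k a b - (ball a σ).indicator (fun _ => 1) b) * (v b - v a)‖ₑ ∂μ :=
            enorm_integral_le_lintegral_enorm _
        _ ≤ ∫⁻ b, ((A a).indicator (fun b => ‖v b‖ₑ) b + (A a).indicator (fun _ => ‖v a‖ₑ) b)
              ∂μ := by
            refine lintegral_mono fun b => ?_
            have h1 := hkσ a b
            rw [enorm_mul]
            by_cases hb : b ∈ A a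
            · rw [indicator_of_mem hb, indicator_of_mem hb]
              have h2 : ‖k a b - (ball a σ).indicator (fun _ => 1) b‖ₑ ≤ 1 := by
                rw [Real.enorm_eq_ofReal_abs]
                exact ENNReal.ofReal_le_one.2 (hd1 b)
              exact (mul_le_mul' h2 (enorm_sub_le)).trans (by rw [one_mul])
            · rw [indicator_of_notMem hb] at h1
              rw [abs_nonpos_iff.1 h1]
              simp
        _ = _ := by
            rw [lintegral_add_left (hv.enorm.indicator (hAm' a)),
              lintegral_indicator_const (hAm' a)]
  have hdefm : Measurable fun a => μ (ball a σ) * ‖(⨍ b in ball a σ, v b ∂μ) - v a‖ₑ :=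
    (measurable_measure_ball σ).mul ((measurable_setAverage_ball hv σ).sub hv).enorm
  have hindm : Measurable fun p : X × X => (A p.1).indicator (fun b => ‖v b‖ₑ) p.2 :=
    (hv.enorm.comp measurable_snd).indicator hAm
  have hsubt : ball x t ⊆ ball x (t + ρ) := ball_subset_ball (by linarith)
  calc _ ≤ ∫⁻ a in ball x t, (μ (ball a σ) * ‖(⨍ b in ball a σ, v b ∂μ) - v a‖ₑ +
        (∫⁻ b, (A a).indicator (fun b => ‖v b‖ₑ) b ∂μ + ‖v a‖ₑ * μ (A a))) ∂μ :=
        setLIntegral_mono' measurableSet_ball hpt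
    _ = ∫⁻ a in ball x t, μ (ball a σ) * ‖(⨍ b in ball a σ, v b ∂μ) - v a‖ₑ ∂μ +
        (∫⁻ a in ball x t, ∫⁻ b, (A a).indicator (fun b => ‖v b‖ₑ) b ∂μ ∂μ +
          ∫⁻ a in ball x t, ‖v a‖ₑ * μ (A a) ∂μ) := by
        rw [lintegral_add_left hdefm, lintegral_add_left (hindm.lintegral_prod_right' (ν := μ))]
    _ ≤ _ := by
        gcongr
        rw [two_mul, mul_add]
        gcongr
        · rw [lintegral_lintegral_swap hindm.aemeasurable, ← lintegral_const_mul _ hv.enorm,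
            ← lintegral_indicator measurableSet_ball]
          refine lintegral_mono fun b => ?_
          by_cases hb : b ∈ ball x (t + ρ)
          · rw [indicator_of_mem hb]
            calc _ ≤ ∫⁻ a, (A b).indicator (fun _ => ‖v b‖ₑ) a ∂μ := by
                  refine (setLIntegral_le_lintegral _ _).trans (lintegral_mono fun a => ?_)
                  simp only [indicator, hAsymm a b, le_refl]
              _ = ‖v b‖ₑ * μ (A b) := lintegral_indicator_const (hAm' b) _
              _ ≤ ‖v b‖ₑ * κ := by gcongr; exact hκ b hb
              _ = _ := mul_comm _ _
          · rw [indicator_of_notMem hb, nonpos_iff_eq_zero]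
            rw [setLIntegral_congr_fun (g := fun _ => 0) measurableSet_ball fun a ha =>
              indicator_of_notMem (fun h => hb (hAball a b h ha)) _]
            simp
        · rw [← lintegral_const_mul _ hv.enorm]
          refine (lintegral_mono_set hsubt).trans (setLIntegral_mono' measurableSet_ball
            fun a ha => ?_)
          rw [mul_comm]
          gcongr
          exact hκ a ha

end

/-! ### Annuli and mean value defects in the rescaled spaces -/

theorem IsMetricMeasure.rescaledMeasure {X : Type u} [MetricSpace X] [MeasurableSpace X]
    {μ : Measure X} (hμ : IsMetricMeasure μ) (x : X) {s : ℝ} (hs : 0 < s) :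
    IsMetricMeasure (rescaledMeasure μ x s) where
  ball_pos y r hr := by
    simp only [AMVBlowup.rescaledMeasure, Measure.smul_apply, smul_eq_mul]
    exact ENNReal.mul_pos (ENNReal.inv_ne_zero.2 (hμ.ball_lt_top x s).ne) (hμ.ball_pos y r hr).ne'
  ball_lt_top y r := by
    simp only [AMVBlowup.rescaledMeasure, Measure.smul_apply, smul_eq_mul]
    exact ENNReal.mul_lt_top (ENNReal.inv_lt_top.2 (hμ.ball_pos x s hs)) (hμ.ball_lt_top y r)

theorem setAverage_rescaledMeasure {X : Type u} [MetricSpace X] [MeasurableSpace X]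
    {μ : Measure X} (hμ : IsMetricMeasure μ) (x : X) {s : ℝ} (hs : 0 < s) (f : X → ℝ) (B : Set X) :
    ⨍ b in B, f b ∂(rescaledMeasure μ x s) = ⨍ b in B, f b ∂μ := by
  have h1 : ((μ (ball x s))⁻¹).toReal ≠ 0 :=
    (ENNReal.toReal_pos (ENNReal.inv_ne_zero.2 (hμ.ball_lt_top x s).ne)
      (ENNReal.inv_ne_top.2 (hμ.ball_pos x s hs).ne')).ne'
  rw [setAverage_eq, setAverage_eq, rescaledMeasure, Measure.restrict_smul, integral_smul_measure,
    measureReal_ennreal_smul_apply, smul_smul, mul_inv_rev, mul_assoc, inv_mul_cancel₀ h1, mul_one]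

theorem exists_ne_zero_mul_le {V κ : ℝ≥0∞} (hV : V ≠ ∞) (hκ : κ ≠ 0) :
    ∃ ε : ℝ≥0∞, ε ≠ 0 ∧ ε * V ≤ κ := by
  have hV1 : V + 1 ≠ ∞ := by finiteness
  refine ⟨κ / (V + 1), (ENNReal.div_pos hκ hV1).ne', ?_⟩
  calc κ / (V + 1) * V ≤ κ / (V + 1) * (V + 1) := by gcongr; exact le_self_add
    _ = κ := ENNReal.div_mul_cancel (by simp) hV1

theorem abs_cutoff_sub_indicator_le {X : Type u} [MetricSpace X] {R δ s σ : ℝ} (hR : 0 < R)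
    (hδ : 0 < δ) (hs : 0 < s)
    (hσ : (1 - δ) * (R * s) ≤ σ) (hσR : σ ≤ R * s) (a b : X) :
    |cutoff R δ (dist a b / s) - (ball a σ).indicator (fun _ => 1) b| ≤
      {b | (1 - δ) * (R * s) ≤ dist a b ∧ dist a b < R * s}.indicator (fun _ => 1) b := by
  rcases lt_or_ge (dist a b) ((1 - δ) * (R * s)) with h1 | h1
  · have hb : b ∈ ball a σ := by rw [mem_ball, dist_comm]; exact h1.trans_le hσ
    rw [cutoff_eq_one hR hδ (by rw [div_le_iff₀ hs]; linarith), indicator_of_mem hb, sub_self,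
      abs_zero]
    exact indicator_nonneg (fun _ _ => zero_le_one) b
  rcases le_or_gt (R * s) (dist a b) with h2 | h2
  · have hb : b ∉ ball a σ := by rw [mem_ball, dist_comm, not_lt]; exact hσR.trans h2
    rw [cutoff_eq_zero hR hδ (by rw [le_div_iff₀ hs]; exact h2), indicator_of_notMem hb, sub_self,
      abs_zero]
    exact indicator_nonneg (fun _ _ => zero_le_one) b
  · rw [indicator_of_mem (s := {b | (1 - δ) * (R * s) ≤ dist a b ∧ dist a b < R * s}) ⟨h1, h2⟩]
    have h3 := cutoff_nonneg R δ (dist a b / s)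
    have h4 := cutoff_le_one R δ (dist a b / s)
    rw [abs_le]
    by_cases hb : b ∈ ball a σ
    · rw [indicator_of_mem hb]; constructor <;> linarith
    · rw [indicator_of_notMem hb]; constructor <;> linarith

theorem measurable_rescaledFun {X : Type u} [MeasurableSpace X] {Ω : Set X} {f : X → ℝ}
    (hΩ : MeasurableSet Ω)
    (hf : Measurable (Ω.indicator f)) (x : X) (s : ℝ) : Measurable (rescaledFun Ω f x s) := by
  have : rescaledFun Ω f x s = Ω.indicator fun a => (Ω.indicator f a - f x) / s := by
    ext a
    by_cases ha : a ∈ Ω <;> simp [rescaledFun, ha]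
  rw [this]
  exact ((hf.sub_const _).div_const _).indicator hΩ

section

variable {X : Type u} [MetricSpace X] [ProperSpace X] [MeasurableSpace X] [BorelSpace X]
  {μ : Measure X} {x : X} {s : ℕ → ℝ}

/-- Annular decay in the rescaled spaces, uniformly on balls about the base point. -/
theorem exists_rescaled_annulus_le (hdoubling : IsLocallyDoubling μ) (hlength : IsLengthSpace X)
    (hs : ∀ m, 0 < s m) (hs0 : Tendsto s atTop (𝓝 0))
    (hM : ∀ R : ℝ, ∃ C : ℝ≥0∞, C ≠ ∞ ∧
      ∀ᶠ m in atTop, rescaledMeasure μ x (s m) (ball x (R * s m)) ≤ C)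
    (T : ℝ) {R : ℝ} (hR : 0 < R) {κ : ℝ≥0∞} (hκ : κ ≠ 0) :
    ∃ δ : ℝ, 0 < δ ∧ δ < 1 ∧ ∀ᶠ m in atTop, ∀ a ∈ ball x (T * s m),
      rescaledMeasure μ x (s m) {b | (1 - δ) * (R * s m) ≤ dist a b ∧
        dist a b < (1 + δ) * (R * s m)} ≤ κ := by
  obtain ⟨C, hC, hCev⟩ := hM (T + 2 * R)
  obtain ⟨τ, hτ, hτC⟩ := exists_ne_zero_mul_le hC hκ
  obtain ⟨δ, r₀, hδ, hδ1, hr₀, hann⟩ := exists_measure_annulus_le hdoubling hlength x hτ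
  have hsmall : ∀ c : ℝ, ∀ᶠ m in atTop, c * s m < r₀ := fun c => by
    have := hs0.const_mul c
    rw [mul_zero] at this
    exact this.eventually (gt_mem_nhds hr₀)
  refine ⟨δ, hδ, hδ1, ?_⟩
  filter_upwards [hCev, hsmall T, hsmall R] with m hm1 hm2 hm3 a ha
  have h1 := hann a (ball_subset_ball hm2.le ha) (R * s m) (mul_pos hR (hs m)) hm3
  have h2 : ball a (2 * (R * s m)) ⊆ ball x ((T + 2 * R) * s m) := fun b hb => by
    rw [mem_ball] at *
    linarith [dist_triangle b a x]
  calc _ ≤ (μ (ball x (s m)))⁻¹ * (τ * μ (ball x ((T + 2 * R) * s m))) := by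
        rw [rescaledMeasure, Measure.smul_apply, smul_eq_mul]
        gcongr
        exact h1.trans (by gcongr)
    _ = τ * rescaledMeasure μ x (s m) (ball x ((T + 2 * R) * s m)) := by
        rw [rescaledMeasure, Measure.smul_apply, smul_eq_mul]; ring
    _ ≤ τ * C := by gcongr
    _ ≤ κ := hτC

/-- The mean value defect of the rescaled functions with the kernel `cutoff R δ` is small in `L¹` on
balls: it is compared with the averages over balls of the radius `σ`, slightly less than `R * s m`,
at which the decay of the mean value defect is known. -/
theorem exists_rescaled_defect_le (hμ : IsMetricMeasure μ) (hdoubling : IsLocallyDoubling μ)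
    (hlength : IsLengthSpace X) {Ω : Set X} (hΩ : IsOpen Ω) (hxΩ : x ∈ Ω) {f : X → ℝ}
    (hf : Measurable (Ω.indicator f)) (hs : ∀ m, 0 < s m) (hs0 : Tendsto s atTop (𝓝 0))
    (hscale : ∀ q T : ℝ, q < 1 → ∃ T₁ : ℝ, ∀ ε : ℝ≥0∞, ε ≠ 0 → ∃ ρ₀ : ℝ, 0 < ρ₀ ∧
      ∀ ρ : ℝ, 0 < ρ → ρ < ρ₀ → ∃ σ : ℝ, q * ρ ≤ σ ∧ σ ≤ ρ ∧ 0 < σ ∧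
        ∫⁻ y in ball x (T * ρ), ‖(⨍ b in ball y σ, Ω.indicator f b ∂μ) - Ω.indicator f y‖ₑ ∂μ ≤
          ε * (ENNReal.ofReal ρ * μ (ball x (T₁ * ρ))))
    (hM : ∀ R : ℝ, ∃ C : ℝ≥0∞, C ≠ ∞ ∧
      ∀ᶠ m in atTop, rescaledMeasure μ x (s m) (ball x (R * s m)) ≤ C)
    (hU : ∀ R : ℝ, ∃ C : ℝ≥0∞, C ≠ ∞ ∧ ∀ᶠ m in atTop,
      IntegrableOn (rescaledFun Ω f x (s m)) (ball x (R * s m)) (rescaledMeasure μ x (s m)) ∧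
      ∫⁻ a in ball x (R * s m), ‖rescaledFun Ω f x (s m) a‖ₑ ∂(rescaledMeasure μ x (s m)) ≤ C)
    (T : ℝ) {R : ℝ} (hR : 0 < R) {κ : ℝ≥0∞} (hκ : κ ≠ 0) :
    ∃ δ₀ : ℝ, 0 < δ₀ ∧ δ₀ < 1 ∧ ∀ δ : ℝ, 0 < δ → δ ≤ δ₀ → ∀ᶠ m in atTop,
      ∫⁻ a in ball x (T * s m), ‖∫ b, cutoff R δ (dist a b / s m) *
        (rescaledFun Ω f x (s m) b - rescaledFun Ω f x (s m) a) ∂(rescaledMeasure μ x (s m))‖ₑ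
          ∂(rescaledMeasure μ x (s m)) ≤ κ := by
  obtain ⟨A, hA, hAev⟩ := hM (T + R)
  obtain ⟨V, hV, hVev⟩ := hU (T + R)
  have hκ2 : κ / 2 ≠ 0 := (ENNReal.div_pos hκ (by norm_num)).ne'
  obtain ⟨κ₁, hκ₁, hκV⟩ := exists_ne_zero_mul_le (show 2 * V ≠ ∞ by finiteness) hκ2
  obtain ⟨δ₀, hδ₀, hδ₀1, hann⟩ :=
    exists_rescaled_annulus_le hdoubling hlength hs hs0 hM (T + R) hR hκ₁
  refine ⟨δ₀, hδ₀, hδ₀1, fun δ hδ hδδ₀ => ?_⟩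
  obtain ⟨T₁, hT₁⟩ := hscale (1 - δ) (T / R) (by linarith)
  obtain ⟨A₁, hA₁, hA₁ev⟩ := hM (T₁ * R)
  obtain ⟨ε, hε, hεA⟩ := exists_ne_zero_mul_le
    (show A * (ENNReal.ofReal R * A₁) ≠ ∞ by finiteness) hκ2
  obtain ⟨ρ₀, hρ₀, hρ⟩ := hT₁ ε hε
  obtain ⟨r, hr, hrΩ⟩ := Metric.isOpen_iff.1 hΩ x hxΩ
  have hsmall : ∀ c : ℝ, ∀ r > 0, ∀ᶠ m in atTop, c * s m < r := fun c r hr => by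
    have := hs0.const_mul c
    rw [mul_zero] at this
    exact this.eventually (gt_mem_nhds hr)
  filter_upwards [hAev, hVev, hann, hA₁ev, hsmall R ρ₀ hρ₀, hsmall (T + R) r hr] with
    m hmA ⟨hmint, hmV⟩ hmann hmA₁ hmρ hmr
  have hsm := hs m
  have hRs : 0 < R * s m := mul_pos hR hsm
  obtain ⟨σ, hqσ, hσR, hσ, hσint⟩ := hρ (R * s m) hRs hmρ
  have hTR : T / R * (R * s m) = T * s m := by field_simp
  have hTRs : T * s m + R * s m = (T + R) * s m := by ring
  rw [hTR, ← mul_assoc T₁] at hσint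
  have hmain := lintegral_kernel_defect_le (hμ.rescaledMeasure x hsm)
    (measurable_rescaledFun hΩ.measurableSet hf x (s m))
    (k := fun a b => cutoff R δ (dist a b / s m)) (l := (1 - δ) * (R * s m)) (σ := σ)
    (ρ := R * s m) (t := T * s m) (x := x) (κ := κ₁)
    (((lipschitzWith_cutoff R δ).continuous.comp
      ((continuous_fst.dist continuous_snd).div_const _)).measurable) hσ hσR
    (abs_cutoff_sub_indicator_le hR hδ hsm hqσ hσR)
    (by rw [hTRs]; exact hmint) (fun a ha => by
      rw [hTRs] at ha
      refine (measure_mono fun b hb => ?_).trans (hmann a ha)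
      exact ⟨le_trans (by gcongr) hb.1, hb.2.trans_le (by nlinarith)⟩)
  rw [hTRs] at hmain
  refine hmain.trans ?_
  have hpt : ∀ a ∈ ball x (T * s m), rescaledMeasure μ x (s m) (ball a σ) *
      ‖(⨍ b in ball a σ, rescaledFun Ω f x (s m) b ∂(rescaledMeasure μ x (s m))) -
        rescaledFun Ω f x (s m) a‖ₑ ≤ A * ((ENNReal.ofReal (s m))⁻¹ *
          ‖(⨍ b in ball a σ, Ω.indicator f b ∂μ) - Ω.indicator f a‖ₑ) := by
    intro a ha
    have hsub : ball a σ ⊆ ball x ((T + R) * s m) := fun b hb => by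
      rw [mem_ball] at *
      linarith [dist_triangle b a x]
    have hsubΩ : ball x ((T + R) * s m) ⊆ Ω := (ball_subset_ball hmr.le).trans hrΩ
    have haΩ : a ∈ Ω := hsubΩ (hsub (mem_ball_self hσ))
    refine mul_le_mul' ((measure_mono hsub).trans hmA) (le_of_eq ?_)
    have hne : μ.real (ball a σ) ≠ 0 :=
      (ENNReal.toReal_pos (hμ.ball_pos a σ hσ).ne' (hμ.ball_lt_top a σ).ne).ne'
    have hU1 : ∀ b ∈ Ω, rescaledFun Ω f x (s m) b = (Ω.indicator f b - f x) / s m := fun b hb => by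
      simp [rescaledFun, hb]
    have hFint : IntegrableOn (Ω.indicator f) (ball a σ) μ := by
      have h1 : IntegrableOn (rescaledFun Ω f x (s m)) (ball a σ) μ := by
        have h2 := hmint.mono_set hsub
        rw [rescaledMeasure, IntegrableOn, Measure.restrict_smul, integrable_smul_measure
          (ENNReal.inv_ne_zero.2 (hμ.ball_lt_top x _).ne)
          (ENNReal.inv_ne_top.2 (hμ.ball_pos x _ hsm).ne')] at h2
        exact h2
      have h3 : IntegrableOn (fun b => s m * rescaledFun Ω f x (s m) b + f x) (ball a σ) μ :=
        (h1.const_mul (s m)).add (integrableOn_const (hμ.ball_lt_top a σ).ne)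
      refine h3.congr_fun (fun b hb => ?_) measurableSet_ball
      simp only [hU1 b (hsubΩ (hsub hb))]
      field_simp
      ring
    rw [setAverage_rescaledMeasure hμ x hsm, setAverage_congr_fun
      (g := fun b => (Ω.indicator f b - f x) / s m) measurableSet_ball
      (ae_of_all _ fun b hb => hU1 b (hsubΩ (hsub hb))), hU1 a haΩ, setAverage_eq, setAverage_eq,
      integral_div, integral_sub hFint (integrableOn_const (hμ.ball_lt_top a σ).ne),
      setIntegral_const, smul_eq_mul, smul_eq_mul, smul_eq_mul]
    have h3 : (ENNReal.ofReal (s m))⁻¹ = ‖(s m)⁻¹‖ₑ := by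
      rw [Real.enorm_eq_ofReal (inv_pos.2 hsm).le, ENNReal.ofReal_inv_of_pos hsm]
    rw [h3, ← enorm_mul]
    congr 1
    field_simp
    ring
  have hDm : Measurable fun a => ‖(⨍ b in ball a σ, Ω.indicator f b ∂μ) - Ω.indicator f a‖ₑ := by
    have := hμ.isLocallyFiniteMeasure
    exact ((measurable_setAverage_ball hf σ).sub hf).enorm
  calc _ ≤ ∫⁻ a in ball x (T * s m), A * ((ENNReal.ofReal (s m))⁻¹ *
          ‖(⨍ b in ball a σ, Ω.indicator f b ∂μ) - Ω.indicator f a‖ₑ)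
            ∂(rescaledMeasure μ x (s m)) + κ₁ * (2 * V) := by
        refine add_le_add (setLIntegral_mono' measurableSet_ball hpt) ?_
        gcongr
    _ ≤ ε * (A * (ENNReal.ofReal R * A₁)) + κ / 2 := by
        gcongr
        rw [lintegral_const_mul _ (hDm.const_mul _), lintegral_const_mul _ hDm]
        nth_rw 1 [rescaledMeasure]
        rw [Measure.restrict_smul, lintegral_smul_measure, smul_eq_mul]
        calc _ ≤ A * ((ENNReal.ofReal (s m))⁻¹ * ((μ (ball x (s m)))⁻¹ *
              (ε * (ENNReal.ofReal (R * s m) * μ (ball x (T₁ * R * s m)))))) := by gcongr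
          _ = ε * (A * (ENNReal.ofReal R * rescaledMeasure μ x (s m) (ball x (T₁ * R * s m)))) *
                ((ENNReal.ofReal (s m))⁻¹ * ENNReal.ofReal (s m)) := by
              rw [ENNReal.ofReal_mul hR.le, rescaledMeasure, Measure.smul_apply, smul_eq_mul]
              ring
          _ ≤ _ := by
              rw [ENNReal.inv_mul_cancel (by simpa using hsm) ENNReal.ofReal_ne_top, mul_one]
              gcongr
    _ ≤ κ / 2 + κ / 2 := by gcongr
    _ = κ := ENNReal.add_halves κ

end

/-! ### Consequences of weak convergence to an approximate tangent -/

section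

variable {X : Type u} [MeasurableSpace X] {Y : Type v} [MeasurableSpace Y] {Z : Type w}
  [MetricSpace Z]
  {ι : ℕ → X → Z} {j : Y → Z} {μ : ℕ → Measure X} {ν : Measure Y} {q : Z}
  {g h : ℕ → X → ℝ} {g' h' : Y → ℝ}

theorem EventuallyLocallyBounded.sub (hg : EventuallyLocallyBounded ι μ q g)
    (hh : EventuallyLocallyBounded ι μ q h) :
    EventuallyLocallyBounded ι μ q fun m a => g m a - h m a := by
  intro R
  obtain ⟨C, hC, hCev⟩ := hg R
  obtain ⟨D, hD, hDev⟩ := hh R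
  refine ⟨C + D, by positivity, ?_⟩
  filter_upwards [hCev, hDev] with m ⟨hm1, hm2⟩ ⟨hm3, hm4⟩
  refine ⟨hm1.sub hm3, ?_⟩
  calc _ ≤ ∫ a in ι m ⁻¹' ball q R, (|g m a| + |h m a|) ∂(μ m) :=
        integral_mono (hm1.sub hm3).abs (hm1.abs.add hm3.abs) fun a => abs_sub _ _
    _ = _ := integral_add hm1.abs hm3.abs
    _ ≤ _ := add_le_add hm2 hm4

variable [MeasurableSpace Z] [BorelSpace Z]

/-- Weakly convergent sequences of positive measures are locally bounded. -/
theorem PushforwardsConvergeWeakly.eventuallyLocallyBounded (hι : ∀ m, Measurable (ι m))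
    (hw : PushforwardsConvergeWeakly ι j μ ν g g')
    (hint : ∀ R, ∀ᶠ m in atTop, IntegrableOn (g m) (ι m ⁻¹' ball q R) (μ m))
    (hg : ∀ m a, 0 ≤ g m a) : EventuallyLocallyBounded ι μ q g := by
  intro R
  set r : ℝ := 2 * (|R| + 1) with hr
  have hr0 : 0 < r := by positivity
  have hsupp : Function.support (fun z => cutoff r (1 / 2) (dist z q)) ⊆ ball q r := fun z hz => by
    by_contra h
    exact hz (cutoff_eq_zero hr0 (by norm_num) (by simpa using h))
  have hcont : Continuous fun z => cutoff r (1 / 2) (dist z q) :=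
    (lipschitzWith_cutoff r (1 / 2)).continuous.comp (continuous_id.dist continuous_const)
  have hlim := hw _ hcont (isBounded_ball.subset hsupp)
  set I := ∫ b, cutoff r (1 / 2) (dist (j b) q) * g' b ∂ν
  refine ⟨|I| + 1, by positivity, ?_⟩
  filter_upwards [hint R, hint r, hlim.eventually (gt_mem_nhds (lt_add_one I))] with m hm1 hm2 hm3
  refine ⟨hm1, ?_⟩
  rw [← integral_indicator (hι m measurableSet_ball)]
  refine le_trans (integral_mono_of_nonneg (ae_of_all _ fun a => indicator_nonneg
    (fun _ _ => abs_nonneg _) a) (integrable_comp_mul hcont.measurable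
    (fun z => abs_cutoff_le_one r _ _) hsupp (hι m) hm2) (ae_of_all _ fun a => ?_))
    (hm3.le.trans (by linarith [le_abs_self I]))
  by_cases ha : a ∈ ι m ⁻¹' ball q R
  · have h1 : dist (ι m a) q < R := ha
    simp only
    rw [indicator_of_mem ha, abs_of_nonneg (hg m a), cutoff_eq_one hr0 (by norm_num)
      (by rw [hr]; linarith [le_abs_self R]), one_mul]
  · rw [indicator_of_notMem ha]
    exact mul_nonneg (cutoff_nonneg _ _ _) (hg m a)

theorem PushforwardsConvergeWeakly.sub [ProperSpace Z] (hι : ∀ m, Measurable (ι m))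
    (hj : Measurable j)
    (hwg : PushforwardsConvergeWeakly ι j μ ν g g') (hbg : EventuallyLocallyBounded ι μ q g)
    (hwh : PushforwardsConvergeWeakly ι j μ ν h h') (hbh : EventuallyLocallyBounded ι μ q h)
    (hg' : ∀ R, IntegrableOn g' (j ⁻¹' ball q R) ν)
    (hh' : ∀ R, IntegrableOn h' (j ⁻¹' ball q R) ν) :
    PushforwardsConvergeWeakly ι j μ ν (fun m a => g m a - h m a) fun b => g' b - h' b := by
  intro φ hφ hsupp
  obtain ⟨T, hT⟩ := hsupp.subset_ball q
  obtain ⟨B, -, hB⟩ := exists_abs_le_of_support_subset_ball hφ hT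
  obtain ⟨C, -, hC⟩ := hbg T
  obtain ⟨D, -, hD⟩ := hbh T
  have hlim := (hwg φ hφ hsupp).sub (hwh φ hφ hsupp)
  simp_rw [mul_sub]
  rw [integral_sub (integrable_comp_mul hφ.measurable hB hT hj (hg' T))
    (integrable_comp_mul hφ.measurable hB hT hj (hh' T))]
  refine hlim.congr' ?_
  filter_upwards [hC, hD] with m hm1 hm2
  rw [integral_sub (integrable_comp_mul hφ.measurable hB hT (hι m) hm1.1)
    (integrable_comp_mul hφ.measurable hB hT (hι m) hm2.1)]

variable {η : ℝ → ℝ} {L : ℝ≥0} {R T : ℝ}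

theorem integrable_kernel {i : X → Z} (hi : Measurable i) {μ : Measure X} {g : X → ℝ}
    (hη : LipschitzWith L η) (hηR : ∀ t, R ≤ t → η t = 0) (hη1 : ∀ t, |η t| ≤ 1)
    (hg : IntegrableOn g (i ⁻¹' ball q (T + R)) μ) {z : Z} (hz : z ∈ ball q T) :
    Integrable (fun b => η (dist z (i b)) * g b) μ := by
  refine integrable_comp_mul (q := z) (T := R) (Φ := fun z' => η (dist z z'))
    (hη.continuous.comp (continuous_const.dist continuous_id)).measurable (fun _ => hη1 _)
    (fun z' hz' => ?_) hi (hg.mono_set (preimage_mono fun z' hz' => ?_))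
  · rw [mem_ball, dist_comm]
    by_contra h
    exact hz' (hηR _ (not_lt.1 h))
  · rw [mem_ball] at *
    linarith [dist_triangle z' z q]

theorem integrable_kernel_mul [ProperSpace Z] {i : X → Z} (hi : Measurable i) {μ : Measure X}
    [SFinite μ] {g h : X → ℝ} (hgm : Measurable g)
    (hη : LipschitzWith L η) (hηR : ∀ t, R ≤ t → η t = 0) (hη1 : ∀ t, |η t| ≤ 1)
    (hg : IntegrableOn g (i ⁻¹' ball q (T + R)) μ) (hh : IntegrableOn h (i ⁻¹' ball q T) μ)
    {φ : Z → ℝ} (hφ : Continuous φ) (hT : Function.support φ ⊆ ball q T) :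
    Integrable (fun a => φ (i a) * (∫ b, η (dist (i a) (i b)) * g b ∂μ) * h a) μ := by
  obtain ⟨B, hB0, hB⟩ := exists_abs_le_of_support_subset_ball hφ hT
  have hm : Measurable fun p : Z × X => η (dist p.1 (i p.2)) * g p.2 :=
    (hη.continuous.measurable.comp
      (measurable_fst.dist (hi.comp measurable_snd))).mul (hgm.comp measurable_snd)
  refine integrable_comp_mul (Φ := fun z => φ z * ∫ b, η (dist z (i b)) * g b ∂μ)
    (B := B * ∫ b in i ⁻¹' ball q (T + R), |g b| ∂μ)
    (hφ.measurable.mul (hm.stronglyMeasurable.integral_prod_right' (ν := μ)).measurable)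
    (fun z => ?_) (fun z hz => hT fun h => hz (by simp only [h, zero_mul])) hi hh
  by_cases hz : φ z = 0
  · simp only [hz, zero_mul, abs_zero]
    positivity
  · rw [abs_mul]
    gcongr
    · exact hB z
    · have hzT := hT hz
      rw [← setIntegral_eq_integral_of_forall_compl_eq_zero (s := i ⁻¹' ball q (T + R))]
      · rw [← Real.norm_eq_abs]
        refine norm_integral_le_of_norm_le hg.abs (ae_of_all _ fun b => ?_)
        rw [norm_mul, Real.norm_eq_abs, Real.norm_eq_abs]
        exact mul_le_of_le_one_left (abs_nonneg _) (hη1 _)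
      · intro b hb
        rw [mem_preimage, mem_ball, not_lt] at hb
        rw [mem_ball] at hzT
        rw [hηR _ (by linarith [dist_triangle (i b) z q, dist_comm z (i b)]), zero_mul]

end

/-- The continuous kernels approximate the averages over balls. -/
theorem tendsto_integral_cutoff {Y : Type v} [MetricSpace Y] [ProperSpace Y] [MeasurableSpace Y]
    [BorelSpace Y] {ν : Measure Y} (hν : IsMetricMeasure ν) {g h : Y → ℝ}
    (hg : LocallyIntegrable g ν) (hh : LocallyIntegrable h ν) {ψ : Y → ℝ} (hψ : Measurable ψ)
    {B T R : ℝ} (hB : ∀ y, |ψ y| ≤ B) {y₀ : Y} (hT : Function.support ψ ⊆ ball y₀ T) (hR : 0 < R)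
    {δ : ℕ → ℝ} (hδ : ∀ k, 0 < δ k) (hδ0 : Tendsto δ atTop (𝓝 0)) :
    Tendsto (fun k => ∫ y, ψ y * (∫ b, cutoff R (δ k) (dist y b) * g b ∂ν) * h y ∂ν) atTop
      (𝓝 (∫ y, ψ y * (∫ b in ball y R, g b ∂ν) * h y ∂ν)) := by
  have := hν.isLocallyFiniteMeasure
  have hball : ∀ {g : Y → ℝ}, LocallyIntegrable g ν → ∀ y r, IntegrableOn g (ball y r) ν :=
    fun hg y r => (hg.integrableOn_isCompact (isCompact_closedBall y r)).mono_set
      ball_subset_closedBall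
  have hcutc : ∀ k, Continuous (cutoff R (δ k)) := fun k => (lipschitzWith_cutoff R (δ k)).continuous
  have hle : ∀ k y b, ‖cutoff R (δ k) (dist y b) * g b‖ ≤ (ball y R).indicator (fun b => |g b|) b := by
    intro k y b
    by_cases hb : b ∈ ball y R
    · rw [indicator_of_mem hb, norm_mul, Real.norm_eq_abs, Real.norm_eq_abs]
      exact mul_le_of_le_one_left (abs_nonneg _) (abs_cutoff_le_one _ _ _)
    · rw [indicator_of_notMem hb, cutoff_eq_zero hR (hδ k)
        (by rw [mem_ball, not_lt, dist_comm] at hb; exact hb), zero_mul, norm_zero]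
  have hinner : ∀ y, Tendsto (fun k => ∫ b, cutoff R (δ k) (dist y b) * g b ∂ν) atTop
      (𝓝 (∫ b in ball y R, g b ∂ν)) := by
    intro y
    rw [← integral_indicator measurableSet_ball]
    refine tendsto_integral_of_dominated_convergence ((ball y R).indicator fun b => |g b|)
      (fun k => ((hcutc k).comp (continuous_const.dist continuous_id)).aestronglyMeasurable.mul
        hg.aestronglyMeasurable)
      (IntegrableOn.integrable_indicator (hball hg y R).abs measurableSet_ball)
      (fun k => ae_of_all _ fun b => hle k y b) (ae_of_all _ fun b => ?_)
    by_cases hb : b ∈ ball y R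
    · rw [indicator_of_mem hb]
      rw [mem_ball, dist_comm] at hb
      have hlim : Tendsto (fun k => (1 - δ k) * R) atTop (𝓝 ((1 - 0) * R)) :=
        (tendsto_const_nhds.sub hδ0).mul_const R
      refine tendsto_const_nhds.congr' ?_
      filter_upwards [hlim.eventually (lt_mem_nhds (by linarith : dist y b < (1 - 0) * R))] with k hk
      rw [cutoff_eq_one hR (hδ k) hk.le, one_mul]
    · rw [indicator_of_notMem hb]
      refine tendsto_const_nhds.congr fun k => ?_
      rw [cutoff_eq_zero hR (hδ k) (by rw [mem_ball, not_lt, dist_comm] at hb; exact hb), zero_mul]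
  have hψh : Integrable (fun y => ψ y * h y) ν :=
    integrable_comp_mul (i := id) hψ hB hT measurable_id (hball hh y₀ T)
  refine tendsto_integral_of_dominated_convergence
    (fun y => (∫ b in ball y₀ (T + R), |g b| ∂ν) * |ψ y * h y|) (fun k => ?_)
    (hψh.abs.const_mul _) (fun k => ae_of_all _ fun y => ?_)
    (ae_of_all _ fun y => ((hinner y).const_mul (ψ y)).mul_const (h y))
  · have h1 : AEStronglyMeasurable (fun p : Y × Y => cutoff R (δ k) (dist p.1 p.2) * g p.2)
        (ν.prod ν) :=
      ((hcutc k).comp (continuous_fst.dist continuous_snd)).aestronglyMeasurable.mul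
        hg.aestronglyMeasurable.comp_snd
    exact (hψ.aestronglyMeasurable.mul h1.integral_prod_right').mul hh.aestronglyMeasurable
  · rw [Real.norm_eq_abs, mul_right_comm, abs_mul, mul_comm]
    by_cases hy : ψ y = 0
    · simp [hy]
    · gcongr
      have hsub : ball y R ⊆ ball y₀ (T + R) := fun b hb => by
        have := hT hy
        rw [mem_ball] at *
        linarith [dist_triangle b y y₀]
      rw [← integral_indicator measurableSet_ball, ← Real.norm_eq_abs]
      exact norm_integral_le_of_norm_le (IntegrableOn.integrable_indicator (hball hg y₀ _).abs
        measurableSet_ball) (ae_of_all _ fun b => (hle k y b).trans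
          (indicator_le_indicator_of_subset hsub (fun _ => abs_nonneg _) b))

/-- Spheres in the limit space are null sets, as the measure of thin annuli about nearby points of
the rescaled spaces is uniformly small. -/
theorem measure_sphere_eq_zero {X : Type u} [MeasurableSpace X] {Y : Type v} [MetricSpace Y]
    [ProperSpace Y] [MeasurableSpace Y] [BorelSpace Y] {ν : Measure Y} (hν : IsMetricMeasure ν)
    {Z : Type w} [MetricSpace Z] {ι : ℕ → X → Z} {j : Y → Z} (hj : Isometry j)
    {M : ℕ → Measure X} (hw : PushforwardsConvergeWeakly ι j M ν (fun _ _ => 1) fun _ => 1)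
    {y : Y} {R : ℝ} (hR : 0 < R)
    (hann : ∀ κ : ℝ≥0∞, κ ≠ 0 → ∃ δ : ℝ, 0 < δ ∧ δ < 1 ∧ ∀ᶠ m in atTop, ∀ a,
      ι m a ∈ ball (j y) 1 → M m {b | (1 - δ) * R ≤ dist (ι m a) (ι m b) ∧
        dist (ι m a) (ι m b) < (1 + δ) * R} ≤ κ) :
    ν (sphere y R) = 0 := by
  have := hν.isLocallyFiniteMeasure
  have := hν.isOpenPosMeasure
  have hle : ∀ κ : ℝ, 0 < κ → ν.real (sphere y R) ≤ κ := by
    intro κ hκ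
    obtain ⟨δ, hδ, hδ1, hev⟩ := hann (ENNReal.ofReal κ) (by simpa using hκ)
    set ε : ℝ := min (δ * R / 2) 1 with hε
    have hε0 : 0 < ε := by positivity
    have hε1 : ε ≤ δ * R / 2 := min_le_left _ _
    -- a bump about `j y`, which yields points `ι m a` near `j y`
    have hbump : ∀ᶠ m in atTop, ∃ a, ι m a ∈ ball (j y) ε := by
      have hcont : Continuous fun z => max 0 (ε - dist z (j y)) :=
        continuous_const.max (continuous_const.sub (continuous_id.dist continuous_const))
      have hsupp : Function.support (fun z => max 0 (ε - dist z (j y))) ⊆ ball (j y) ε :=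
        fun z hz => by
          by_contra h
          exact hz (max_eq_left (by simpa using h))
      have hlim := hw _ hcont (isBounded_ball.subset hsupp)
      have hpos : 0 < ∫ b, max 0 (ε - dist (j b) (j y)) * 1 ∂ν := by
        simp_rw [mul_one, hj.dist_eq]
        refine Continuous.integral_pos_of_hasCompactSupport_nonneg_nonzero
          (continuous_const.max (continuous_const.sub (continuous_id.dist continuous_const)))
          (HasCompactSupport.intro (isCompact_closedBall y ε) fun b hb => ?_)
          (fun b => le_max_left _ _) (x := y) ?_
        · rw [mem_closedBall, not_le] at hb
          exact max_eq_left (by linarith)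
        · simp [hε0.le, hε0.ne']
      filter_upwards [hlim.eventually (lt_mem_nhds hpos)] with m hm
      by_contra! hcon
      refine absurd hm (not_lt.2 (le_of_eq ?_))
      refine integral_eq_zero_of_ae (ae_of_all _ fun a => ?_)
      have : max 0 (ε - dist (ι m a) (j y)) = 0 := by
        by_contra h
        exact hcon a (hsupp h)
      simp [this]
    -- a bump about the sphere
    set χ : Z → ℝ := fun z => max 0 (1 - |dist z (j y) - R| / ε) with hχ
    have hχcont : Continuous χ := continuous_const.max (continuous_const.sub
      (((continuous_id.dist continuous_const).sub continuous_const).abs.div_const _))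
    have hχ0 : ∀ z, ε ≤ |dist z (j y) - R| → χ z = 0 := fun z hz =>
      max_eq_left (by rw [sub_nonpos, le_div_iff₀ hε0]; linarith)
    have hχ1 : ∀ z, χ z ≤ 1 := fun z => max_le zero_le_one (by
      have : 0 ≤ |dist z (j y) - R| / ε := by positivity
      linarith)
    have hsupp : Function.support χ ⊆ ball (j y) (R + ε) := fun z hz => by
      by_contra h
      rw [mem_ball, not_lt] at h
      exact hz (hχ0 z (le_trans (by linarith) (le_abs_self _)))
    have hlim := hw χ hχcont (isBounded_ball.subset hsupp)
    have h1 : ν.real (sphere y R) ≤ ∫ b, χ (j b) * 1 ∂ν := by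
      rw [← integral_indicator_one isClosed_sphere.measurableSet]
      refine integral_mono_of_nonneg (ae_of_all _ fun b => indicator_nonneg
        (fun _ _ => zero_le_one) b) ?_ (ae_of_all _ fun b => ?_)
      · simp_rw [mul_one]
        refine (hχcont.comp hj.continuous).integrable_of_hasCompactSupport
          (HasCompactSupport.intro (isCompact_closedBall y (R + ε)) fun b hb => ?_)
        by_contra h
        refine hb (ball_subset_closedBall ?_)
        have := hsupp h
        rwa [mem_ball, hj.dist_eq] at this
      · by_cases hb : b ∈ sphere y R
        · rw [indicator_of_mem hb]
          rw [mem_sphere] at hb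
          simp [hχ, hj.dist_eq, hb]
        · rw [indicator_of_notMem hb]
          exact mul_nonneg (le_max_left _ _) zero_le_one
    refine h1.trans (le_of_tendsto hlim ?_)
    filter_upwards [hbump, hev] with m ⟨a, ha⟩ hm
    have hκ' := hm a (ball_subset_ball (min_le_right _ _) ha)
    set S := {b | (1 - δ) * R ≤ dist (ι m a) (ι m b) ∧ dist (ι m a) (ι m b) < (1 + δ) * R}
    have hχS : ∀ b, b ∉ S → χ (ι m b) = 0 := fun b hb => hχ0 _ (by
      by_contra! h
      rw [abs_lt] at h
      rw [mem_ball] at ha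
      refine hb ⟨?_, ?_⟩
      · linarith [dist_triangle (ι m b) (ι m a) (j y), dist_comm (ι m a) (ι m b)]
      · linarith [dist_triangle (ι m b) (j y) (ι m a), dist_comm (ι m a) (ι m b),
          dist_comm (ι m a) (j y)])
    have h2 : ∫ b, χ (ι m b) * 1 ∂(M m) = ∫ b in S, χ (ι m b) * 1 ∂(M m) :=
      (setIntegral_eq_integral_of_forall_compl_eq_zero fun b hb => by
        rw [hχS b hb, zero_mul]).symm
    rw [h2]
    refine (Real.le_norm_self _).trans ((norm_setIntegral_le_of_norm_le_const (C := 1)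
      (hκ'.trans_lt ENNReal.ofReal_lt_top) fun b _ => ?_).trans ?_)
    · rw [mul_one, Real.norm_of_nonneg (le_max_left _ _)]
      exact hχ1 _
    · rw [one_mul]
      exact ENNReal.toReal_le_of_le_ofReal hκ.le hκ'
  have h0 : ν.real (sphere y R) = 0 :=
    le_antisymm (le_of_forall_pos_le_add fun ε hε => by simpa using hle ε hε) measureReal_nonneg
  exact (measureReal_eq_zero_iff (isCompact_sphere y R).measure_lt_top.ne).1 h0

/-! ### The mean value property of approximate tangents -/

/-- The mean value property of the weak limit, tested with continuous functions: the mean value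
defect with a continuous kernel is a difference of double integrals which pass to the limit, and the
kernel is then replaced by that of the averages over balls. -/
theorem integral_mul_setIntegral_ball_eq {X : Type u} [MeasurableSpace X] {Y : Type v}
    [MetricSpace Y] [ProperSpace Y] [MeasurableSpace Y] [BorelSpace Y] {ν : Measure Y}
    (hν : IsMetricMeasure ν) {Z : Type w} [MetricSpace Z] [ProperSpace Z] [MeasurableSpace Z]
    [BorelSpace Z] {ι : ℕ → X → Z} (hι : ∀ m, Measurable (ι m)) {j : Y → Z} (hj : Isometry j)
    {y₀ : Y} {M : ℕ → Measure X} [∀ m, SFinite (M m)] {g : ℕ → X → ℝ} {g' : Y → ℝ}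
    (hgm : ∀ m, Measurable (g m)) (hg' : LocallyIntegrable g' ν)
    (hw : PushforwardsConvergeWeakly ι j M ν g g') (hb : EventuallyLocallyBounded ι M (j y₀) g)
    (hw1 : PushforwardsConvergeWeakly ι j M ν (fun _ _ => 1) fun _ => 1)
    (hb1 : EventuallyLocallyBounded ι M (j y₀) fun _ _ => 1) {R T : ℝ} (hR : 0 < R)
    (hdefect : ∀ κ : ℝ≥0∞, κ ≠ 0 → ∃ δ₀ : ℝ, 0 < δ₀ ∧ ∀ δ : ℝ, 0 < δ → δ ≤ δ₀ → ∀ᶠ m in atTop,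
      ∫⁻ a in ι m ⁻¹' ball (j y₀) T, ‖∫ b, cutoff R δ (dist (ι m a) (ι m b)) *
        (g m b - g m a) ∂(M m)‖ₑ ∂(M m) ≤ κ)
    {φ : Z → ℝ} (hφ : Continuous φ) (hT : Function.support φ ⊆ ball (j y₀) T) :
    ∫ y, φ (j y) * (∫ b in ball y R, g' b ∂ν) * 1 ∂ν =
      ∫ y, φ (j y) * (∫ _ in ball y R, 1 ∂ν) * g' y ∂ν := by
  have := hν.isLocallyFiniteMeasure
  obtain ⟨B, hB0, hB⟩ := exists_abs_le_of_support_subset_ball hφ hT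
  have h1' : LocallyIntegrable (fun _ : Y => (1 : ℝ)) ν := locallyIntegrable_const _
  set I : ℝ → ℝ := fun δ => ∫ y, φ (j y) * (∫ b, cutoff R δ (dist y b) * g' b ∂ν) * 1 ∂ν -
    ∫ y, φ (j y) * (∫ b, cutoff R δ (dist y b) * 1 ∂ν) * g' y ∂ν with hI
  have hIle : ∀ κ : ℝ, 0 < κ → ∃ δ₀ : ℝ, 0 < δ₀ ∧ ∀ δ, 0 < δ → δ ≤ δ₀ → |I δ| ≤ κ := by
    intro κ hκ
    have hκ' : 0 < κ / (B + 1) := by positivity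
    obtain ⟨δ₀, hδ₀, hδ₀'⟩ := hdefect (ENNReal.ofReal (κ / (B + 1))) (by simpa using hκ')
    refine ⟨δ₀, hδ₀, fun δ hδ hδδ₀ => ?_⟩
    have hLip := lipschitzWith_cutoff R δ
    have hzero : ∀ t, R ≤ t → cutoff R δ t = 0 := fun t ht => cutoff_eq_zero hR hδ ht
    have hlim := (tendsto_double_integral hι hgm hw hb hw1 hb1 hLip hzero
      (abs_cutoff_le_one R δ) hφ hT).sub (tendsto_double_integral hι
        (fun _ => measurable_const) hw1 hb1 hw hb hLip hzero (abs_cutoff_le_one R δ) hφ hT)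
    simp_rw [hj.dist_eq] at hlim
    refine le_of_tendsto hlim.abs ?_
    obtain ⟨C, -, hC⟩ := hb (T + R)
    obtain ⟨C', -, hC'⟩ := hb1 (T + R)
    filter_upwards [hδ₀' δ hδ hδδ₀, hC, hC'] with m hm ⟨hgi, _⟩ ⟨h1i, _⟩
    have hsub : ι m ⁻¹' ball (j y₀) T ⊆ ι m ⁻¹' ball (j y₀) (T + R) :=
      preimage_mono (ball_subset_ball (by linarith))
    rw [← integral_sub (integrable_kernel_mul (hι m) (hgm m) hLip hzero (abs_cutoff_le_one R δ) hgi
      (h1i.mono_set hsub) hφ hT) (integrable_kernel_mul (hι m) measurable_const hLip hzero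
        (abs_cutoff_le_one R δ) h1i (hgi.mono_set hsub) hφ hT)]
    have hpt : ∀ a, φ (ι m a) * (∫ b, cutoff R δ (dist (ι m a) (ι m b)) * g m b ∂(M m)) * 1 -
        φ (ι m a) * (∫ b, cutoff R δ (dist (ι m a) (ι m b)) * 1 ∂(M m)) * g m a =
        φ (ι m a) * ∫ b, cutoff R δ (dist (ι m a) (ι m b)) * (g m b - g m a) ∂(M m) := by
      intro a
      by_cases ha : φ (ι m a) = 0
      · simp [ha]
      · have haT := hT ha
        have hi1 := integrable_kernel (hι m) hLip hzero (abs_cutoff_le_one R δ) hgi haT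
        have hi2 := integrable_kernel (hι m) hLip hzero (abs_cutoff_le_one R δ) h1i haT
        have : ∫ b, cutoff R δ (dist (ι m a) (ι m b)) * (g m b - g m a) ∂(M m) =
            ∫ b, cutoff R δ (dist (ι m a) (ι m b)) * g m b ∂(M m) -
              (∫ b, cutoff R δ (dist (ι m a) (ι m b)) * 1 ∂(M m)) * g m a := by
          rw [← integral_mul_const, ← integral_sub hi1 (hi2.mul_const _)]
          refine integral_congr_ae (ae_of_all _ fun b => ?_)
          simp only
          ring
        rw [this]
        ring
    simp_rw [hpt]
    rw [← Real.norm_eq_abs, ← toReal_enorm]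
    refine ENNReal.toReal_le_of_le_ofReal hκ.le ?_
    calc _ ≤ ∫⁻ a, ‖φ (ι m a) * ∫ b, cutoff R δ (dist (ι m a) (ι m b)) *
            (g m b - g m a) ∂(M m)‖ₑ ∂(M m) := enorm_integral_le_lintegral_enorm _
      _ ≤ ∫⁻ a, (ι m ⁻¹' ball (j y₀) T).indicator (fun a => ENNReal.ofReal B *
            ‖∫ b, cutoff R δ (dist (ι m a) (ι m b)) * (g m b - g m a) ∂(M m)‖ₑ) a ∂(M m) := by
          refine lintegral_mono fun a => ?_
          by_cases ha : φ (ι m a) = 0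
          · simp [ha]
          · rw [indicator_of_mem (s := ι m ⁻¹' ball (j y₀) T) (hT ha), enorm_mul]
            gcongr
            rw [Real.enorm_eq_ofReal_abs]
            exact ENNReal.ofReal_le_ofReal (hB _)
      _ = ENNReal.ofReal B * ∫⁻ a in ι m ⁻¹' ball (j y₀) T,
            ‖∫ b, cutoff R δ (dist (ι m a) (ι m b)) * (g m b - g m a) ∂(M m)‖ₑ ∂(M m) := by
          rw [lintegral_indicator (hι m measurableSet_ball),
            lintegral_const_mul' _ _ ENNReal.ofReal_ne_top]
      _ ≤ ENNReal.ofReal B * ENNReal.ofReal (κ / (B + 1)) := by gcongr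
      _ = ENNReal.ofReal (B * (κ / (B + 1))) := (ENNReal.ofReal_mul hB0).symm
      _ ≤ ENNReal.ofReal κ := by
          refine ENNReal.ofReal_le_ofReal ?_
          calc B * (κ / (B + 1)) ≤ (B + 1) * (κ / (B + 1)) := by gcongr; linarith
            _ = κ := by field_simp
  have hpos : ∀ k : ℕ, (0 : ℝ) < 1 / ((k : ℝ) + 1) := fun k => Nat.one_div_pos_of_nat
  have hzero := tendsto_one_div_add_atTop_nhds_zero_nat (𝕜 := ℝ)
  have hψ : Measurable fun y => φ (j y) := (hφ.comp hj.continuous).measurable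
  have hψT : Function.support (fun y => φ (j y)) ⊆ ball y₀ T := fun y hy => by
    have := hT hy
    rwa [mem_ball, hj.dist_eq] at this
  have hlim := (tendsto_integral_cutoff hν hg' h1' hψ (fun y => hB (j y)) hψT hR hpos hzero).sub
    (tendsto_integral_cutoff hν h1' hg' hψ (fun y => hB (j y)) hψT hR hpos hzero)
  have hlim0 : Tendsto (fun k : ℕ => I (1 / ((k : ℝ) + 1))) atTop (𝓝 0) := by
    rw [Metric.tendsto_nhds]
    intro κ hκ
    obtain ⟨δ₀, hδ₀, hle⟩ := hIle (κ / 2) (by positivity)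
    filter_upwards [hzero.eventually (gt_mem_nhds hδ₀)] with k hk
    rw [dist_zero_right, Real.norm_eq_abs]
    linarith [hle _ (hpos k) hk.le]
  exact sub_eq_zero.1 (tendsto_nhds_unique hlim hlim0)

/-- The mean value property tested with continuous functions on `Z` implies that the mean value
defect has integral zero over compact sets, whose indicator functions are limits of such functions
along `j`. -/
theorem setIntegral_ball_defect_eq_zero {Y : Type v} [MetricSpace Y] [ProperSpace Y]
    [MeasurableSpace Y] [BorelSpace Y] {ν : Measure Y} (hν : IsMetricMeasure ν) {Z : Type w}
    [MetricSpace Z] {j : Y → Z} (hj : Isometry j) {y₀ : Y} {u : Y → ℝ}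
    (hu : LocallyIntegrable u ν) {R : ℝ} (hsphere : ∀ y, ν (sphere y R) = 0)
    (htest : ∀ (φ : Z → ℝ) (T : ℝ), Continuous φ → Function.support φ ⊆ ball (j y₀) T →
      ∫ y, φ (j y) * (∫ b in ball y R, u b ∂ν) * 1 ∂ν =
        ∫ y, φ (j y) * (∫ _ in ball y R, 1 ∂ν) * u y ∂ν) {K : Set Y} (hK : IsCompact K) :
    ∫ y in K, ((∫ b in ball y R, u b ∂ν) - ν.real (ball y R) * u y) ∂ν = 0 := by
  have := hν.isLocallyFiniteMeasure
  rcases K.eq_empty_or_nonempty with rfl | hKne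
  · simp
  set E : Y → ℝ := fun y => (∫ b in ball y R, u b ∂ν) - ν.real (ball y R) * u y with hE
  have hElocal : LocallyIntegrable E ν := locallyIntegrable_ball_defect hν hu hsphere
  obtain ⟨T, hT⟩ := hK.isBounded.subset_ball y₀
  have hball : ∀ {g : Y → ℝ}, LocallyIntegrable g ν → IntegrableOn g (ball y₀ (T + 1)) ν :=
    fun hg => (hg.integrableOn_isCompact (isCompact_closedBall y₀ (T + 1))).mono_set
      ball_subset_closedBall
  set φ : ℕ → Z → ℝ := fun n z => max 0 (1 - ((n : ℝ) + 1) * infDist z (j '' K)) with hφ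
  have hφc : ∀ n, Continuous (φ n) := fun n =>
    continuous_const.max (continuous_const.sub (continuous_const.mul (continuous_infDist_pt _)))
  have hφ1 : ∀ n z, |φ n z| ≤ 1 := fun n z => by
    rw [abs_of_nonneg (le_max_left _ _)]
    refine max_le zero_le_one ?_
    have : 0 ≤ ((n : ℝ) + 1) * infDist z (j '' K) := mul_nonneg (by positivity) infDist_nonneg
    linarith
  have hφs : ∀ n, Function.support (φ n) ⊆ ball (j y₀) (T + 1) := fun n z hz => by
    have h1 : infDist z (j '' K) < 1 := by
      by_contra! h
      refine hz (max_eq_left ?_)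
      have : (1 : ℝ) ≤ ((n : ℝ) + 1) * infDist z (j '' K) :=
        one_le_mul_of_one_le_of_one_le (by simp) h
      linarith
    obtain ⟨_, ⟨y, hy, rfl⟩, hzy⟩ := (infDist_lt_iff (hKne.image j)).1 h1
    have h2 := hT hy
    rw [mem_ball] at *
    rw [← hj.dist_eq] at h2
    linarith [dist_triangle z (j y) (j y₀)]
  have hψs : ∀ n, Function.support (fun y => φ n (j y)) ⊆ ball y₀ (T + 1) := fun n y hy => by
    have := hφs n hy
    rwa [mem_ball, hj.dist_eq] at this
  have hψm : ∀ n, Measurable fun y => φ n (j y) := fun n =>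
    ((hφc n).comp hj.continuous).measurable
  have hzero : ∀ n, ∫ y, φ n (j y) * E y ∂ν = 0 := by
    intro n
    have hreal : ∀ y, ∫ _ in ball y R, (1 : ℝ) ∂ν = ν.real (ball y R) := fun y => by simp
    have hi : ∀ {g : Y → ℝ}, LocallyIntegrable g ν → Integrable (fun y => φ n (j y) * g y) ν :=
      fun hg => integrable_comp_mul (i := id) (Φ := fun y => φ n (j y)) (hψm n)
        (fun y => hφ1 n (j y)) (hψs n) measurable_id (hball hg)
    have h1 := htest (φ n) (T + 1) (hφc n) (hφs n)
    simp_rw [hreal, mul_one, mul_assoc] at h1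
    have hi1 := hi (continuous_setIntegral_ball hu hsphere).locallyIntegrable
    have hcreal : Continuous fun y => ν.real (ball y R) := by
      simpa using continuous_setIntegral_ball (locallyIntegrable_const (1 : ℝ) (μ := ν)) hsphere
    have hi2 := hi (hu.continuous_mul hcreal)
    simp only [hE, mul_sub]
    rw [integral_sub hi1 hi2, h1, sub_self]
  have hlim : Tendsto (fun n => ∫ y, φ n (j y) * E y ∂ν) atTop (𝓝 (∫ y, K.indicator E y ∂ν)) := by
    refine tendsto_integral_of_dominated_convergence
      ((ball y₀ (T + 1)).indicator fun y => |E y|)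
      (fun n => (hψm n).aestronglyMeasurable.mul hElocal.aestronglyMeasurable)
      (IntegrableOn.integrable_indicator (hball hElocal).abs measurableSet_ball)
      (fun n => ae_of_all _ fun y => ?_) (ae_of_all _ fun y => ?_)
    · by_cases hy : φ n (j y) = 0
      · rw [hy, zero_mul, norm_zero]
        exact indicator_nonneg (fun _ _ => abs_nonneg _) y
      · rw [indicator_of_mem (hψs n hy), norm_mul]
        exact mul_le_of_le_one_left (abs_nonneg _) (hφ1 n _)
    · by_cases hy : y ∈ K
      · refine tendsto_const_nhds.congr fun n => ?_
        have : infDist (j y) (j '' K) = 0 := infDist_zero_of_mem (mem_image_of_mem j hy)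
        simp [hφ, this, hy]
      · rw [indicator_of_notMem hy]
        have hpos : 0 < infDist (j y) (j '' K) :=
          ((hK.image hj.continuous).isClosed.notMem_iff_infDist_pos (hKne.image j)).1
            fun ⟨y', hy', h⟩ => hy (hj.injective h ▸ hy')
        obtain ⟨N, hN⟩ := exists_nat_gt (1 / infDist (j y) (j '' K))
        refine tendsto_const_nhds.congr' ?_
        filter_upwards [eventually_ge_atTop N] with n hn
        have h1 : φ n (j y) = 0 := by
          refine max_eq_left ?_
          rw [div_lt_iff₀ hpos] at hN
          have : (N : ℝ) ≤ n := by exact_mod_cast hn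
          nlinarith
        rw [h1, zero_mul]
  rw [← integral_indicator hK.measurableSet]
  simp_rw [hzero] at hlim
  exact tendsto_nhds_unique hlim tendsto_const_nhds

/-- Approximate tangents are mean value harmonic at each point at which the mean value defect decays
in the sense of `ae_exists_scale`, whichever the sequence of scales. -/
theorem IsApproximateTangent.exists_isMeanValueHarmonic {X : Type u} [MetricSpace X]
    [ProperSpace X] [MeasurableSpace X] [BorelSpace X] {μ : Measure X} (hμ : IsMetricMeasure μ)
    (hdoubling : IsLocallyDoubling μ) (hlength : IsLengthSpace X) {Ω : Set X} (hΩ : IsOpen Ω)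
    {x : X} (hxΩ : x ∈ Ω) {f : X → ℝ} (hf : Measurable (Ω.indicator f))
    (hfint : ∀ K : Set X, K ⊆ Ω → IsCompact K → IntegrableOn f K μ)
    (hscale : ∀ q T : ℝ, q < 1 → ∃ T₁ : ℝ, ∀ ε : ℝ≥0∞, ε ≠ 0 → ∃ ρ₀ : ℝ, 0 < ρ₀ ∧
      ∀ ρ : ℝ, 0 < ρ → ρ < ρ₀ → ∃ σ : ℝ, q * ρ ≤ σ ∧ σ ≤ ρ ∧ 0 < σ ∧
        ∫⁻ y in ball x (T * ρ), ‖(⨍ b in ball y σ, Ω.indicator f b ∂μ) - Ω.indicator f y‖ₑ ∂μ ≤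
          ε * (ENNReal.ofReal ρ * μ (ball x (T₁ * ρ))))
    {s : ℕ → ℝ} (hs : ∀ m, 0 < s m) (hs0 : Tendsto s atTop (𝓝 0))
    {Y : Type v} [MetricSpace Y] [ProperSpace Y] [MeasurableSpace Y] [BorelSpace Y]
    {ν : Measure Y} (hν : IsMetricMeasure ν) {y₀ : Y} {f' : Y → ℝ}
    (htan : IsApproximateTangent.{u, v, w} μ Ω f x s ν y₀ f') :
    ∃ h : Y → ℝ, h =ᵐ[ν] f' ∧ IsMeanValueHarmonic ν h := by
  obtain ⟨hf', Z, _, _, ι, j, hreal, hplus, hminus⟩ := htan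
  borelize Z
  have := hν.isLocallyFiniteMeasure
  set M : ℕ → Measure X := fun m => rescaledMeasure μ x (s m) with hMdef
  set U : ℕ → X → ℝ := fun m => rescaledFun Ω f x (s m) with hUdef
  have hMm : ∀ m, IsMetricMeasure (M m) := fun m => hμ.rescaledMeasure x (hs m)
  have hMfin : ∀ m, IsLocallyFiniteMeasure (M m) := fun m => (hMm m).isLocallyFiniteMeasure
  have hUm : ∀ m, Measurable (U m) := fun m =>
    measurable_rescaledFun hΩ.measurableSet hf x (s m)
  have hdist : ∀ m a b, dist (ι m a) (ι m b) = dist a b / s m := hreal.isometry_seq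
  have hj : Isometry j := hreal.isometry_lim
  have hι : ∀ m, Measurable (ι m) := fun m => by
    have : LipschitzWith (Real.nnabs (s m)⁻¹) (ι m) := LipschitzWith.of_dist_le_mul fun a b => by
      rw [hdist, Real.coe_nnabs, abs_of_pos (inv_pos.2 (hs m)), div_eq_inv_mul]
    exact this.continuous.measurable
  have hpre : ∀ m R, ι m ⁻¹' ball (j y₀) R = ball x (R * s m) := fun m R => by
    ext a
    rw [mem_preimage, mem_ball, mem_ball, ← hreal.base_point m, hdist, div_lt_iff₀ (hs m)]
  have hprej : ∀ R, j ⁻¹' ball (j y₀) R = ball y₀ R := fun R => hj.preimage_ball y₀ R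
  have hball : ∀ {g : Y → ℝ}, LocallyIntegrable g ν → ∀ R, IntegrableOn g (j ⁻¹' ball (j y₀) R) ν :=
    fun hg R => by
      rw [hprej]
      exact (hg.integrableOn_isCompact (isCompact_closedBall y₀ R)).mono_set ball_subset_closedBall
  -- integrability and local bounds
  have h1int : ∀ R m, IntegrableOn (fun _ => (1 : ℝ)) (ι m ⁻¹' ball (j y₀) R) (M m) := fun R m => by
    rw [hpre]
    exact integrableOn_const ((hMm m).ball_lt_top _ _).ne
  have hUint : ∀ R, ∀ᶠ m in atTop, IntegrableOn (U m) (ι m ⁻¹' ball (j y₀) R) (M m) := by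
    intro R
    obtain ⟨r, hr, hrΩ⟩ := Metric.isOpen_iff.1 hΩ x hxΩ
    have hlim := hs0.const_mul R
    rw [mul_zero] at hlim
    filter_upwards [hlim.eventually (gt_mem_nhds hr)] with m hm
    have hsub : closedBall x (R * s m) ⊆ Ω := (closedBall_subset_ball hm).trans hrΩ
    have h1 : IntegrableOn (fun a => (f a - f x) / s m) (ball x (R * s m)) μ :=
      (((hfint _ hsub (isCompact_closedBall _ _)).mono_set ball_subset_closedBall).sub
        (integrableOn_const (hμ.ball_lt_top _ _).ne)).div_const _
    have h2 : IntegrableOn (U m) (ball x (R * s m)) μ := h1.congr_fun (fun a ha => by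
      simp [hUdef, rescaledFun, hsub (ball_subset_closedBall ha)]) measurableSet_ball
    rw [hpre]
    simp only [hMdef, rescaledMeasure, IntegrableOn, Measure.restrict_smul]
    exact h2.smul_measure (ENNReal.inv_ne_top.2 (hμ.ball_pos x _ (hs m)).ne')
  have hb1 : EventuallyLocallyBounded ι M (j y₀) fun _ _ => 1 :=
    hreal.weak.eventuallyLocallyBounded hι (fun R => Eventually.of_forall (h1int R))
      fun _ _ => zero_le_one
  have hbplus : EventuallyLocallyBounded ι M (j y₀) fun m a => max (U m a) 0 :=
    hplus.eventuallyLocallyBounded hι (fun R => (hUint R).mono fun m hm => hm.pos_part)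
      fun _ _ => le_max_right _ _
  have hneg : ∀ a : ℝ, -min a 0 = max (-a) 0 := fun a => by rw [← neg_zero, max_neg_neg, neg_zero]
  have hbminus : EventuallyLocallyBounded ι M (j y₀) fun m a => -min (U m a) 0 :=
    hminus.eventuallyLocallyBounded hι (fun R => (hUint R).mono fun m hm => by
      simp_rw [hneg]
      exact hm.neg_part) fun _ _ => neg_nonneg.2 (min_le_right _ _)
  have hparts : ∀ a : ℝ, max a 0 - -min a 0 = a := fun a => by
    rw [sub_neg_eq_add, max_add_min, add_zero]
  have hbU : EventuallyLocallyBounded ι M (j y₀) U := by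
    simpa only [hparts] using hbplus.sub hbminus
  have hwU : PushforwardsConvergeWeakly ι j M ν U f' := by
    have h := hplus.sub hι hj.continuous.measurable hbplus hminus hbminus
      (fun R => (hball hf' R).pos_part) (fun R => by
        simp_rw [hneg]
        exact (hball hf' R).neg_part)
    simpa only [hparts] using h
  have hMb : ∀ R : ℝ, ∃ C : ℝ≥0∞, C ≠ ∞ ∧ ∀ᶠ m in atTop, M m (ball x (R * s m)) ≤ C := by
    intro R
    obtain ⟨C, -, hC⟩ := hb1 R
    refine ⟨ENNReal.ofReal C, ENNReal.ofReal_ne_top, hC.mono fun m hm => ?_⟩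
    have h2 := hm.2
    simp only [hpre, abs_one, integral_const, measureReal_restrict_apply_univ, smul_eq_mul,
      mul_one] at h2
    rw [← ofReal_measureReal ((hMm m).ball_lt_top _ _).ne]
    exact ENNReal.ofReal_le_ofReal h2
  have hUb : ∀ R : ℝ, ∃ C : ℝ≥0∞, C ≠ ∞ ∧ ∀ᶠ m in atTop,
      IntegrableOn (U m) (ball x (R * s m)) (M m) ∧
        ∫⁻ a in ball x (R * s m), ‖U m a‖ₑ ∂(M m) ≤ C := by
    intro R
    obtain ⟨C, -, hC⟩ := hbU R
    refine ⟨ENNReal.ofReal C, ENNReal.ofReal_ne_top, hC.mono fun m hm => ?_⟩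
    rw [hpre] at hm
    refine ⟨hm.1, ?_⟩
    rw [← ofReal_integral_norm_eq_lintegral_enorm hm.1]
    exact ENNReal.ofReal_le_ofReal hm.2
  -- spheres in the limit space
  have hsphere : ∀ y R, 0 < R → ν (sphere y R) = 0 := by
    intro y R hR
    refine measure_sphere_eq_zero hν hj hreal.weak hR fun κ hκ => ?_
    obtain ⟨δ, hδ, hδ1, hev⟩ := exists_rescaled_annulus_le hdoubling hlength hs hs0 hMb
      (dist y y₀ + 1) hR hκ
    refine ⟨δ, hδ, hδ1, hev.mono fun m hm a ha => ?_⟩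
    have hset : {b | (1 - δ) * R ≤ dist (ι m a) (ι m b) ∧ dist (ι m a) (ι m b) < (1 + δ) * R} =
        {b | (1 - δ) * (R * s m) ≤ dist a b ∧ dist a b < (1 + δ) * (R * s m)} := by
      ext b
      simp only [mem_ofPred_eq, hdist, le_div_iff₀ (hs m), div_lt_iff₀ (hs m), mul_assoc]
    rw [hset]
    refine hm a ?_
    rw [← hpre, mem_preimage, mem_ball]
    rw [mem_ball] at ha
    have := hj.dist_eq y y₀
    linarith [dist_triangle (ι m a) (j y) (j y₀)]
  refine AMVBlowup.exists_isMeanValueHarmonic hν hf' hsphere fun R hR K hK => ?_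
  refine setIntegral_ball_defect_eq_zero hν hj (y₀ := y₀) hf' (fun y => hsphere y R hR)
    (fun φ T hφ hT => ?_) hK
  refine integral_mul_setIntegral_ball_eq hν hι hj hUm hf' hwU hbU hreal.weak hb1 hR
    (fun κ hκ => ?_) hφ hT
  obtain ⟨δ₀, hδ₀, -, h⟩ := exists_rescaled_defect_le hμ hdoubling hlength hΩ hxΩ hf hs hs0 hscale
    hMb hUb T hR hκ
  refine ⟨δ₀, hδ₀, fun δ hδ hδδ₀ => (h δ hδ hδδ₀).mono fun m hm => ?_⟩
  rw [hpre]
  simp_rw [hdist]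
  exact hm

end AMVBlowup

theorem theorem1p7 {X : Type u} [MetricSpace X] [ProperSpace X] [MeasurableSpace X]
    [BorelSpace X] (μ : Measure X) (hμ : AMVBlowup.IsMetricMeasure μ)
    (hdoubling : AMVBlowup.IsLocallyDoubling μ) (hlength : AMVBlowup.IsLengthSpace X)
    (Ω : Set X) (hΩ : IsOpen Ω) (p : ℝ≥0∞) (hp_one : 1 < p) (hp_top : p < ∞)
    (f : X → ℝ) (hf_haj : AMVBlowup.MemHajlaszLocOn μ Ω p f)
    (hf_amv : AMVBlowup.MemAMVLocOn μ Ω p f)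
    (r : ℕ → ℝ) (hr_pos : ∀ k, 0 < r k) (hr_lim : Tendsto r atTop (𝓝 0)) :
    ∀ᵐ x ∂μ, x ∈ Ω →
      ∀ (n : ℕ → ℕ), StrictMono n →
      ∀ (Y : Type v) [MetricSpace Y] [ProperSpace Y] [MeasurableSpace Y] [BorelSpace Y]
        (ν : Measure Y) (y₀ : Y) (f' : Y → ℝ), AMVBlowup.IsMetricMeasure ν →
        AMVBlowup.IsApproximateTangent.{u, v, w} μ Ω f x (fun k => r (n k)) ν y₀ f' →
        ∃ h : Y → ℝ, h =ᵐ[ν] f' ∧ AMVBlowup.IsMeanValueHarmonic ν h := by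
  have := hμ.isLocallyFiniteMeasure
  have hf : Measurable (Ω.indicator f) :=
    measurable_of_restrict_of_restrict_compl hΩ.measurableSet (by
      convert hf_haj.1 using 1
      exact funext fun a => indicator_of_mem a.2 f) (by
      convert measurable_const (a := (0 : ℝ)) using 1
      exact funext fun a => indicator_of_notMem a.2 f)
  have hfint : ∀ K : Set X, K ⊆ Ω → IsCompact K → IntegrableOn f K μ := fun K hKΩ hK => by
    have : IsFiniteMeasure (μ.restrict K) := isFiniteMeasure_restrict.2 hK.measure_lt_top.ne
    exact (hf_amv.1 K hKΩ hK).integrable hp_one.le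
  filter_upwards [AMVBlowup.ae_exists_scale hμ hdoubling hΩ hf fun K hK hKΩ =>
    hf_amv.exists_lintegral_le hμ hΩ hp_one.le hf hK hKΩ] with x hx hxΩ n hn Y _ _ _ _ ν y₀ f' hν htan
  exact htan.exists_isMeanValueHarmonic hμ hdoubling hlength hΩ hxΩ hf hfint (hx hxΩ)
    (fun k => hr_pos _) (hr_lim.comp hn.tendsto_atTop) hν
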